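/- **Setting.** Let $D\subset\mathbb R^3$ be a bounded Lipschitz domain whose boundary is divided into measurable parts $\Gamma_1,\dots,\Gamma_5$ overlapping only in null sets for surface measure. Write $\|\cdot\|_{0}$, $\|\cdot\|_{1}$ for the norms of $L^2(D;\mathbb C)$ and $H^1(D;\mathbb C)$, with $\|u\|_1^2=\|u\|_0^2+\|\nabla u\|_0^2$, and $V_0=\{u\in H^1(D;\mathbb C): u|_{\Gamma_1}=0\}$. Let $p_g\in H^1(D;\mathbb C)$ be a weak solution of $-\Delta p_g=0$ in $D$, $p_g=g$ on $\Gamma_1$, $\partial p_g/\partial\mathbf n=0$ on $\partial D\setminus\Gamma_1$. For $\nu=(k,\mu,\xi)$ with $k>0$, $\mu\in\mathbb C$, $\xi\in\mathbb C$, $\operatorname{Re}\xi>0$, put $$a_\nu(u,v)=\int_D\nabla u\cdot\nabla\bar v-k^2\int_D u\bar v+\frac{ik}{\xi}\int_{\Gamma_2}u\bar v\,ds+ik\int_{\Gamma_4}u\bar v\,ds,$$ $$b_\nu(v)=\mu k^2\int_D p_g\bar v-\frac{i\mu k}{\xi}\int_{\Gamma_2}p_g\bar v\,ds-i\mu k\int_{\Gamma_4}p_g\bar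 v\,ds .$$ An exact solution at $\nu$ is $\tilde p\in V_0$ with $a_\nu(\tilde p,v)=b_\nu(v)$ for all $v\in V_0$. Let $V_h\subset V_0$ be a finite-dimensional complex (finite element) subspace with mesh size $h>0$; a finite element solution at $\nu$ is $\tilde p_h\in V_h$ with $a_\nu(\tilde p_h,v)=b_\nu(v)$ for all $v\in V_h$. Let $\mathcal P$ be a set of such parameters $\nu$. **POD.** Let $\nu_1,\dots,\nu_m\in\mathcal P$ ($m\ge1$), with exact solutions $\tilde p_S^j$ and finite element solutions (snapshots) $\tilde p_{S,h}^j$ at $\nu_j$. Let $\mathbb K\in\{\mathbb R,\mathbb C\}$; all inner products in the POD are the Hermitian ones if $\mathbb K=\mathbb C$, and their real parts (functions regarded as pairs of real functions) if $\mathbb K=\mathbb R$. Let $\mathbf C=[\langle\tilde p_{S,h}^j,\tilde p_{S,h}^i\rangle_{L^2}]_{i,j}\in\mathbb K^{m\times m}$, $d=\operatorname{rank}\mathbf C$, let $\lambda_1\ge\dots\ge\lambda_d>0$ be its nonzero eigenvalues with orthonormal eigenvectors $\mathbf u_1,\dots,\mathbf u_d\in\mathbb K^m$, and $\varphi_i=\lambda_i^{-1/2}\sum_j(\mathbf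 u_i)_j\,\tilde p_{S,h}^j$. For $0\le N\le d$ let $V_R$ be the $\mathbb K$-span of $\varphi_1,\dots,\varphi_N$, let $\Pi_R$ be the $L^2$ projection onto $V_R$ ($\|u-\Pi_Ru\|_0=\inf_{v\in V_R}\|u-v\|_0$), and let $\mathbb S_{jk}=\langle\varphi_k,\varphi_j\rangle+\langle\nabla\varphi_k,\nabla\varphi_j\rangle$; $\|\mathbb S\|_2$ denotes the matrix 2-norm of the $N\times N$ matrix $(\mathbb S_{jk})_{j,k\le N}$. The reduced model is either the complex one, in which $A_\nu=a_\nu$, $B_\nu=b_\nu$, or its real formulation, in which $A_\nu=\operatorname{Re}a_\nu$, $B_\nu=\operatorname{Re}b_\nu$. A reduced solution at $\nu$ is $\tilde p_R\in V_R$ with $A_\nu(\tilde p_R,v)=B_\nu(v)$ for all $v\in V_R$. **Assumptions.** (i) There is a continuous $C_{\rm FE}:\mathcal P\to\mathbb R$ with $\|\tilde p-\tilde p_h\|_1\le C_{\rm FE}(\nu)\,h$ for every $\nu\in\mathcal P$ and all exact and finite element solutions $\tilde p,\tilde p_h$ at $\nu$. (ii) There is a function $\beta_R(k,\xi)$, continuous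 on the set of $(k,\xi)$ occurring in $\mathcal P$, with $$0<\beta_R(k,\xi)\le\inf_{u\in V_R\setminus0}\ \sup_{v\in V_R\setminus0}\frac{|A_\nu(u,v)|}{\|u\|_1\|v\|_1}\qquad\text{for all }\nu=(k,\mu,\xi)\in\mathcal P .$$ **Proposition.** There is a positive continuous function $C(k,\xi)$ on $\{k>0,\ \operatorname{Re}\xi>0\}$, depending only on $D$ and $\Gamma_1,\dots,\Gamma_5$, such that in every situation as above, under (i) and (ii), for every $\nu=(k,\mu,\xi)\in\mathcal P$, every exact solution $\tilde p$ and every reduced solution $\tilde p_R$ at $\nu$, $$\|\tilde p-\tilde p_R\|_1\le\Big(1+\frac{C(k,\xi)}{\beta_R(k,\xi)}\Big)\|\tilde p-\Pi_R\tilde p\|_1 ,$$ and $$\|\tilde p-\Pi_R\tilde p\|_1\le\big(1+\|\mathbb S\|_2^{1/2}\big)\inf_{1\le j\le m}\Big(\|\tilde p-\tilde p_S^j\|_1+C_{\rm FE}(\nu_j)h\Big)+\Big(\sum_{i=N+1}^d\lambda_i\mathbb S_{ii}\Big)^{1/2}.$$ -/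

import Mathlib

open MeasureTheory Filter Topology
open scoped ContDiff ENNReal

noncomputable section

namespace HelmholtzPOD

/-! ## Lipschitz domains and surface measure -/

/-- Physical space `ℝ³` with the Euclidean norm. -/
abbrev Space := EuclideanSpace ℝ (Fin 3)

/-- The boundary of `D` is Lipschitz: near each boundary point, in suitable Cartesian coordinates
`e`, the set `D` is the region strictly below the graph of a Lipschitz function `γ`. -/
def HasLipschitzBoundary (D : Set Space) : Prop :=
  ∀ x ∈ frontier D, ∃ (r : ℝ) (e : Space ≃ₗᵢ[ℝ] Space) (K : NNReal)
    (γ : EuclideanSpace ℝ (Fin 2) → ℝ), 0 < r ∧ LipschitzWith K γ ∧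
      ∀ y ∈ Metric.ball x r, y ∈ D ↔ (e y) 2 < γ !₂[(e y) 0, (e y) 1]

/-- Surface measure on `∂D`: the two-dimensional Hausdorff measure, normalized so that it agrees
with Lebesgue measure on planes. -/
def surfaceMeasure (D : Set Space) : Measure Space :=
  (Measure.euclideanHausdorffMeasure 2).restrict (frontier D)

/-- A bounded Lipschitz domain in `ℝ³` whose boundary is split into five measurable parts
`Γ₁, …, Γ₅` (indexed here by `0, …, 4`), overlapping at most in sets of zero surface measure. -/
structure AcousticDomain where
  D : Set Space
  isOpen : IsOpen D
  isConnected : IsConnected D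
  isBounded : Bornology.IsBounded D
  lipschitz : HasLipschitzBoundary D
  Γ : Fin 5 → Set Space
  measurableSet_Γ : ∀ i, MeasurableSet (Γ i)
  iUnion_Γ : ⋃ i, Γ i = frontier D
  overlap_Γ : ∀ i j, i ≠ j → surfaceMeasure D (Γ i ∩ Γ j) = 0

/-! ## The Sobolev space `H¹(D; ℂ)` -/

/-- `L²(D; ℂ)`. -/
abbrev L2 (D : Set Space) : Type := Lp ℂ 2 (volume.restrict D)

/-- `L²(D; ℂ³)`. -/
abbrev L2Vec (D : Set Space) : Type := Lp (EuclideanSpace ℂ (Fin 3)) 2 (volume.restrict D)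

/-- `i`-th partial derivative of a function on `ℝ³`. -/
def partialDeriv {F : Type*} [NormedAddCommGroup F] [NormedSpace ℝ F] (i : Fin 3)
    (w : Space → F) (x : Space) : F :=
  fderiv ℝ w x (EuclideanSpace.single i 1)

/-- Test functions `C_c^∞(D; ℝ)`. -/
def IsTestFunction (D : Set Space) (φ : Space → ℝ) : Prop :=
  ContDiff ℝ ∞ φ ∧ HasCompactSupport φ ∧ tsupport φ ⊆ D

/-- `G` is the weak gradient of `u` on `D`. -/
def IsWeakGradient (D : Set Space) (u : L2 D) (G : L2Vec D) : Prop :=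
  ∀ φ : Space → ℝ, IsTestFunction D φ → ∀ i : Fin 3,
    ∫ x in D, u x * ((partialDeriv i φ x : ℝ) : ℂ) = -∫ x in D, G x i * (φ x : ℂ)

theorem integrable_mul_partialDeriv {D : Set Space} (u : L2 D) {φ : Space → ℝ}
    (hφ : IsTestFunction D φ) (i : Fin 3) :
    Integrable (fun x => u x * ((partialDeriv i φ x : ℝ) : ℂ)) (volume.restrict D) := by
  have hc : Continuous (partialDeriv i φ) :=
    (hφ.1.continuous_fderiv (by simp)).clm_apply continuous_const
  have hs : HasCompactSupport (partialDeriv i φ) := hφ.2.1.fderiv_apply ℝ _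
  have h : MemLp (fun x => ((partialDeriv i φ x : ℝ) : ℂ)) 2 (volume.restrict D) :=
    ((Complex.continuous_ofReal.comp hc).memLp_of_hasCompactSupport
      (hs.comp_left Complex.ofReal_zero)).restrict D
  exact (Lp.memLp u).integrable_mul h

theorem integrable_mul_testFunction {D : Set Space} (G : L2Vec D) {φ : Space → ℝ}
    (hφ : IsTestFunction D φ) (i : Fin 3) :
    Integrable (fun x => G x i * (φ x : ℂ)) (volume.restrict D) := by
  have h : MemLp (fun x => (φ x : ℂ)) 2 (volume.restrict D) :=
    ((Complex.continuous_ofReal.comp hφ.1.continuous).memLp_of_hasCompactSupport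
      (hφ.2.1.comp_left Complex.ofReal_zero)).restrict D
  exact ((EuclideanSpace.proj (𝕜 := ℂ) i).comp_memLp' (Lp.memLp G)).integrable_mul h

/-- `H¹(D; ℂ)`: pairs `(u, ∇u)` of an `L²` function and its weak gradient, as a subspace of the
Hilbert sum `L²(D; ℂ) ⊕ L²(D; ℂ³)`. The inherited norm and inner product are
`‖u‖₁² = ‖u‖₀² + ‖∇u‖₀²` and `⟨u, v⟩ + ⟨∇u, ∇v⟩`. -/
def sobolevH1 (D : Set Space) : Submodule ℂ (WithLp 2 (L2 D × L2Vec D)) where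
  carrier := {p | IsWeakGradient D p.fst p.snd}
  zero_mem' := by
    intro φ _ i
    have h1 : ∫ x in D, (0 : L2 D) x * ((partialDeriv i φ x : ℝ) : ℂ) = ∫ x in D, (0 : ℂ) := by
      refine integral_congr_ae ?_
      filter_upwards [Lp.coeFn_zero ℂ 2 (volume.restrict D)] with x hx
      rw [hx]
      simp
    have h2 : ∫ x in D, (0 : L2Vec D) x i * (φ x : ℂ) = ∫ x in D, (0 : ℂ) := by
      refine integral_congr_ae ?_
      filter_upwards [Lp.coeFn_zero (EuclideanSpace ℂ (Fin 3)) 2 (volume.restrict D)] with x hx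
      rw [hx]
      simp
    change ∫ x in D, (0 : L2 D) x * ((partialDeriv i φ x : ℝ) : ℂ) =
      -∫ x in D, (0 : L2Vec D) x i * (φ x : ℂ)
    rw [h1, h2]
    simp
  add_mem' := by
    intro p q hp hq φ hφ i
    have h1 : ∫ x in D, (p.fst + q.fst : L2 D) x * ((partialDeriv i φ x : ℝ) : ℂ) =
        ∫ x in D, (p.fst x * ((partialDeriv i φ x : ℝ) : ℂ) + q.fst x * ((partialDeriv i φ x : ℝ) : ℂ)) := by
      refine integral_congr_ae ?_
      filter_upwards [Lp.coeFn_add p.fst q.fst] with x hx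
      rw [hx]
      simp [add_mul]
    have h2 : ∫ x in D, (p.snd + q.snd : L2Vec D) x i * (φ x : ℂ) =
        ∫ x in D, (p.snd x i * (φ x : ℂ) + q.snd x i * (φ x : ℂ)) := by
      refine integral_congr_ae ?_
      filter_upwards [Lp.coeFn_add p.snd q.snd] with x hx
      rw [hx]
      simp [add_mul]
    rw [integral_add (integrable_mul_partialDeriv p.fst hφ i)
      (integrable_mul_partialDeriv q.fst hφ i), hp φ hφ i, hq φ hφ i] at h1
    rw [integral_add (integrable_mul_testFunction p.snd hφ i)
      (integrable_mul_testFunction q.snd hφ i)] at h2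
    change ∫ x in D, (p.fst + q.fst : L2 D) x * ((partialDeriv i φ x : ℝ) : ℂ) =
      -∫ x in D, (p.snd + q.snd : L2Vec D) x i * (φ x : ℂ)
    rw [h1, h2]
    ring
  smul_mem' := by
    intro c p hp φ hφ i
    have h1 : ∫ x in D, (c • p.fst : L2 D) x * ((partialDeriv i φ x : ℝ) : ℂ) =
        ∫ x in D, c * (p.fst x * ((partialDeriv i φ x : ℝ) : ℂ)) := by
      refine integral_congr_ae ?_
      filter_upwards [Lp.coeFn_smul c p.fst] with x hx
      rw [hx]
      simp [mul_assoc]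
    have h2 : ∫ x in D, (c • p.snd : L2Vec D) x i * (φ x : ℂ) =
        ∫ x in D, c * (p.snd x i * (φ x : ℂ)) := by
      refine integral_congr_ae ?_
      filter_upwards [Lp.coeFn_smul c p.snd] with x hx
      rw [hx]
      simp [mul_assoc]
    rw [integral_const_mul, hp φ hφ i] at h1
    rw [integral_const_mul] at h2
    change ∫ x in D, (c • p.fst : L2 D) x * ((partialDeriv i φ x : ℝ) : ℂ) =
      -∫ x in D, (c • p.snd : L2Vec D) x i * (φ x : ℂ)
    rw [h1, h2]
    ring

/-- `H¹(D; ℂ)` as a type. -/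
abbrev H1 (D : Set Space) : Type := sobolevH1 D

variable {D : Set Space}

/-- The underlying `L²` function of an element of `H¹`. -/
def H1.fn (u : H1 D) : L2 D := u.1.fst

/-- The weak gradient of an element of `H¹`. -/
def H1.grad (u : H1 D) : L2Vec D := u.1.snd

/-- `t` is the boundary trace of `u`: there are functions smooth up to the boundary that converge
to `u` in `H¹(D)` and whose boundary values converge to `t` in `L²(∂D)`. -/
def IsTrace (u : H1 D) (t : Lp ℂ 2 (surfaceMeasure D)) : Prop :=
  ∃ w : ℕ → Space → ℂ, (∀ n, ContDiff ℝ ∞ (w n)) ∧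
    Tendsto (fun n => eLpNorm (fun x => w n x - u.fn x) 2 (volume.restrict D)) atTop (𝓝 0) ∧
    (∀ i : Fin 3, Tendsto (fun n =>
      eLpNorm (fun x => partialDeriv i (w n) x - u.grad x i) 2 (volume.restrict D))
        atTop (𝓝 0)) ∧
    Tendsto (fun n => eLpNorm (fun x => w n x - t x) 2 (surfaceMeasure D)) atTop (𝓝 0)

open Classical in
/-- The trace operator `H¹(D) → L²(∂D)`. (On a bounded Lipschitz domain every element of `H¹` has
exactly one trace.) -/
def trace (u : H1 D) : Lp ℂ 2 (surfaceMeasure D) :=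
  if h : ∃ t, IsTrace u t then h.choose else 0

/-! ## The Helmholtz problem -/

/-- `V₀ = {u ∈ H¹(D; ℂ) : u = 0 on Γ₁}`. -/
def V0 (Ω : AcousticDomain) : Set (H1 Ω.D) :=
  {u | ∃ t, IsTrace u t ∧ ∀ᵐ x ∂(surfaceMeasure Ω.D).restrict (Ω.Γ 0), t x = 0}

/-- `∫_{Γᵢ} u v̄ ds`. -/
def boundaryInner (Ω : AcousticDomain) (i : Fin 5) (u v : H1 Ω.D) : ℂ :=
  ∫ x in Ω.Γ i, trace u x * (starRingEnd ℂ) (trace v x) ∂(surfaceMeasure Ω.D)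

/-- Parameters `ν = (k, μ, ξ)`: wavenumber, complex source amplitude `μ = μ_r + i μ_i`, complex
impedance factor `ξ`. -/
abbrev Param := ℝ × ℂ × ℂ

/-- `(k, ξ)`, the part of the parameters on which the sesquilinear form depends. -/
def Param.kξ (ν : Param) : ℝ × ℂ := (ν.1, ν.2.2)

/-- The pairs `(k, ξ)` with `k > 0` and `Re ξ > 0`. -/
def admissible : Set (ℝ × ℂ) := {q | 0 < q.1 ∧ 0 < q.2.re}

/-- `a(u, v) = ∫_D ∇u·∇v̄ - k² ∫_D u v̄ + (ik/ξ) ∫_{Γ₂} u v̄ ds + ik ∫_{Γ₄} u v̄ ds`.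
(Mathlib's `inner ℂ x y` is conjugate-linear in `x`.) -/
def helmholtzForm (Ω : AcousticDomain) (ν : Param) (u v : H1 Ω.D) : ℂ :=
  inner ℂ v.grad u.grad - (ν.1 : ℂ) ^ 2 * inner ℂ v.fn u.fn
    + Complex.I * ν.1 / ν.2.2 * boundaryInner Ω 1 u v
    + Complex.I * ν.1 * boundaryInner Ω 3 u v

/-- `b(v) = μ k² ∫_D p_g v̄ - iμ(k/ξ) ∫_{Γ₂} p_g v̄ ds - iμk ∫_{Γ₄} p_g v̄ ds`. -/
def helmholtzRHS (Ω : AcousticDomain) (pg : H1 Ω.D) (ν : Param) (v : H1 Ω.D) : ℂ :=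
  ν.2.1 * (ν.1 : ℂ) ^ 2 * inner ℂ v.fn pg.fn
    - Complex.I * ν.2.1 * (ν.1 / ν.2.2) * boundaryInner Ω 1 pg v
    - Complex.I * ν.2.1 * ν.1 * boundaryInner Ω 3 pg v

/-- `p_g ∈ H¹(D)` is a weak solution of `-Δ p_g = 0` in `D`, `p_g = g` on `Γ₁`,
`∂p_g/∂n = 0` on `∂D ∖ Γ₁`. -/
def IsHarmonicLift (Ω : AcousticDomain) (g : Space → ℂ) (pg : H1 Ω.D) : Prop :=
  (∃ t, IsTrace pg t ∧ ∀ᵐ x ∂(surfaceMeasure Ω.D).restrict (Ω.Γ 0), t x = g x) ∧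
    ∀ v ∈ V0 Ω, inner ℂ v.grad pg.grad = 0

/-- `p̃ ∈ V₀` with `a(p̃, v) = b(v)` for all `v ∈ V₀` (the exact lifted solution). -/
def IsExactSolution (Ω : AcousticDomain) (pg : H1 Ω.D) (ν : Param) (p : H1 Ω.D) : Prop :=
  p ∈ V0 Ω ∧ ∀ v ∈ V0 Ω, helmholtzForm Ω ν p v = helmholtzRHS Ω pg ν v

/-- `p̃_h ∈ V_h` with `a(p̃_h, v) = b(v)` for all `v ∈ V_h` (the finite element solution). -/
def IsFESolution (Ω : AcousticDomain) (Vh : Submodule ℂ (H1 Ω.D)) (pg : H1 Ω.D) (ν : Param)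
    (p : H1 Ω.D) : Prop :=
  p ∈ Vh ∧ ∀ v ∈ Vh, helmholtzForm Ω ν p v = helmholtzRHS Ω pg ν v

/-! ## Proper orthogonal decomposition

`𝕜` is the scalar field of the decomposition: for `𝕜 = ℂ` the snapshots are complex functions and
inner products are Hermitian; for `𝕜 = ℝ` they are regarded as pairs of real functions, with the
real `L²` and `H¹` inner products. `RCLike.map ℂ 𝕜` is the identity or the real part, and
`RCLike.map 𝕜 ℂ` the identity or the inclusion of the reals. -/

section POD

variable (𝕜 : Type) [RCLike 𝕜] {m d : ℕ}

/-- The snapshot correlation matrix, with `(i, j)` entry `⟨pʲ, pⁱ⟩_{L²}`. -/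
def correlationMatrix (snap : Fin m → H1 D) : Matrix (Fin m) (Fin m) 𝕜 :=
  Matrix.of fun i j => RCLike.map ℂ 𝕜 (inner ℂ (snap i).fn (snap j).fn)

variable {𝕜}

/-- `(λᵢ, uᵢ)`, `i = 1, …, d = rank A`, are the eigenpairs of `A` with nonzero eigenvalue:
`λ₁ ≥ ⋯ ≥ λ_d > 0`, with orthonormal eigenvectors. -/
structure IsEigensystem (A : Matrix (Fin m) (Fin m) 𝕜) (lam : Fin d → ℝ)
    (u : Fin d → Fin m → 𝕜) : Prop where
  rank_eq : A.rank = d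
  antitone : Antitone lam
  pos : ∀ i, 0 < lam i
  orthonormal : ∀ i j, star (u i) ⬝ᵥ u j = if i = j then 1 else 0
  eigen : ∀ i, A.mulVec (u i) = (lam i : 𝕜) • u i

/-- The POD modes `φᵢ = λᵢ^{-1/2} ∑ⱼ (uᵢ)ⱼ pʲ`. -/
def podMode (snap : Fin m → H1 D) (lam : Fin d → ℝ) (u : Fin d → Fin m → 𝕜) (i : Fin d) : H1 D :=
  ((1 / Real.sqrt (lam i) : ℝ) : ℂ) • ∑ j, RCLike.map 𝕜 ℂ (u i j) • snap j

variable (𝕜)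

/-- The reduced space `V_R`: the `𝕜`-span of the first `N` modes. -/
def reducedSpace (φ : Fin d → H1 D) (N : ℕ) (hN : N ≤ d) : Set (H1 D) :=
  {v | ∃ c : Fin N → 𝕜, v = ∑ i, RCLike.map 𝕜 ℂ (c i) • φ (Fin.castLE hN i)}

/-- The POD stiffness matrix `𝕊_{jk} = ⟨φ_k, φ_j⟩ + ⟨∇φ_k, ∇φ_j⟩` of a family of functions. -/
def stiffnessMatrix {n : ℕ} (φ : Fin n → H1 D) : Matrix (Fin n) (Fin n) 𝕜 :=
  Matrix.of fun j k =>
    RCLike.map ℂ 𝕜 (inner ℂ (φ j).fn (φ k).fn + inner ℂ (φ j).grad (φ k).grad)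

variable {𝕜}

/-- The matrix 2-norm (operator norm for the Euclidean norm). -/
def twoNorm {n : ℕ} (A : Matrix (Fin n) (Fin n) 𝕜) : ℝ :=
  ‖Matrix.toEuclideanCLM (n := Fin n) (𝕜 := 𝕜) A‖

/-- `P` is the `L²` projection of `u` onto the set `V`. -/
def IsL2Projection (V : Set (H1 D)) (u P : H1 D) : Prop :=
  P ∈ V ∧ ∀ v ∈ V, ‖u.fn - P.fn‖ ≤ ‖u.fn - v.fn‖

end POD

/-! ## The reduced-order model

`𝕃` tells whether the equations of the reduced model are the complex ones (`𝕃 = ℂ`) or those of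
the real formulation, with the real parts of `a` and `b` (`𝕃 = ℝ`). -/

section ROM

variable (𝕃 : Type) [RCLike 𝕃]

/-- `p̃_R ∈ V_R` with `a(p̃_R, v) = b(v)` for all `v ∈ V_R`. -/
def IsReducedSolution (Ω : AcousticDomain) (VR : Set (H1 Ω.D)) (pg : H1 Ω.D) (ν : Param)
    (p : H1 Ω.D) : Prop :=
  p ∈ VR ∧ ∀ v ∈ VR,
    RCLike.map ℂ 𝕃 (helmholtzForm Ω ν p v) = RCLike.map ℂ 𝕃 (helmholtzRHS Ω pg ν v)

/-- The discrete inf-sup constant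
`inf_{u ∈ V_R ∖ 0} sup_{v ∈ V_R ∖ 0} |a(u, v)| / (‖u‖₁ ‖v‖₁)`, with values in `[0, ∞]`. -/
def infSupConstant (Ω : AcousticDomain) (VR : Set (H1 Ω.D)) (ν : Param) : ℝ≥0∞ :=
  ⨅ u ∈ VR \ {0}, ⨆ v ∈ VR \ {0},
    ENNReal.ofReal (‖RCLike.map ℂ 𝕃 (helmholtzForm Ω ν u v)‖ / (‖u‖ * ‖v‖))

end ROM

end HelmholtzPOD

end

noncomputable section

namespace HelmholtzPOD

/-! The first estimate is a Céa argument. The modes are combinations of snapshots, so `V_R ⊆ V_h ⊆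
V₀`, and the exact and reduced equations can both be tested on `V_R`. For `q = Π_R p` this gives
`A(p_R - q, v) = A(p - q, v)` for all `v ∈ V_R`. The inf-sup condition then bounds `‖p_R - q‖₁` by
`(M/β_R) ‖p - q‖₁`, and the triangle inequality finishes. Here `M = 1 + k² + (k/|ξ| + k) T²` bounds
the Helmholtz form, and `T` bounds the trace map (`exists_trace_bound`). `T` comes from graph
coordinates, the fundamental theorem of calculus on vertical segments, Fubini and compactness of the
boundary. Existence of traces on all of `H¹` is never needed: membership in `V₀` supplies it.

The second estimate splits `p - q = (p - p_h) + (p_h - s) - (q - s)`, where `p_h` is a snapshot and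
`s` its modal expansion cut after `N` terms. The expansion holds because each coordinate vector
differs from its projection onto the eigenvectors by an element of `ker C`, and a snapshot
combination with coefficients in `ker C` has zero `L²` norm, hence vanishes in `H¹`
(`IsEigensystem.snap_eq`). The tail `p_h - s` is bounded by Cauchy-Schwarz and Bessel's inequality.
Both `q` and `s` are `L²` projections, so `‖q - s‖₀ ≤ ‖p - p_h‖₀`, and the inverse inequality `‖v‖₁
≤ ‖𝕊‖₂^{1/2} ‖v‖₀` on `V_R` turns this into an `H¹` bound.

The real and complex cases are treated together through `RCLike.map`. -/

/-! ### The trace inequality for smooth functions. -/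

/-- An `L`-Lipschitz map enlarges two-dimensional Hausdorff measure by at most `L²`, and on the
plane the normalized Hausdorff measure is Lebesgue measure. This replaces the area formula for
graphs. -/
theorem setLIntegral_image_euclideanHausdorffMeasure_le {L : NNReal}
    {G : EuclideanSpace ℝ (Fin 2) → Space} (hG : LipschitzWith L G)
    (S : Set (EuclideanSpace ℝ (Fin 2))) {f : Space → ℝ≥0∞} (hf : Measurable f) :
    ∫⁻ y in G '' S, f y ∂(Measure.euclideanHausdorffMeasure 2) ≤
      (L : ℝ≥0∞) ^ 2 * ∫⁻ x in S, f (G x) := by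
  have hle : (Measure.euclideanHausdorffMeasure 2 : Measure Space).restrict (G '' S) ≤
      ((L : ℝ≥0∞) ^ 2) • (volume.restrict S).map G := by
    refine Measure.le_iff.2 fun A hA => ?_
    rw [Measure.restrict_apply hA, Measure.smul_apply, Measure.map_apply hG.continuous.measurable hA,
      Measure.restrict_apply (hG.continuous.measurable hA), Set.inter_comm,
      ← Set.image_inter_preimage, ← EuclideanSpace.euclideanHausdorffMeasure_eq_volume 2, Set.inter_comm]
    simp only [Measure.euclideanHausdorffMeasure_def, Measure.smul_apply, smul_eq_mul]
    have h := hG.hausdorffMeasure_image_le (d := ((2 : ℕ) : ℝ)) (by norm_num) (G ⁻¹' A ∩ S)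
    rw [ENNReal.rpow_natCast] at h
    rw [ENNReal.smul_def, ENNReal.smul_def, smul_eq_mul, smul_eq_mul, mul_left_comm]
    gcongr
  calc _ ≤ ∫⁻ y, f y ∂(((L : ℝ≥0∞) ^ 2) • (volume.restrict S).map G) := lintegral_mono' hle le_rfl
    _ = _ := by rw [lintegral_smul_measure, lintegral_map hf hG.continuous.measurable, smul_eq_mul]

theorem sq_lintegral_le {α : Type*} [MeasurableSpace α] (μ : Measure α) {g : α → ℝ≥0∞}
    (hg : AEMeasurable g μ) : (∫⁻ x, g x ∂μ) ^ 2 ≤ μ Set.univ * ∫⁻ x, g x ^ 2 ∂μ := by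
  have h := ENNReal.lintegral_mul_le_Lp_mul_Lq μ Real.HolderConjugate.two_two
    (f := fun _ => 1) (g := g) aemeasurable_const hg
  simp only [Pi.mul_apply, one_mul, ENNReal.one_rpow, lintegral_one] at h
  calc (∫⁻ x, g x ∂μ) ^ 2 ≤ _ := pow_le_pow_left' h 2
    _ = _ := by
      rw [mul_pow, ← ENNReal.rpow_natCast, ← ENNReal.rpow_natCast, ← ENNReal.rpow_mul,
        ← ENNReal.rpow_mul]
      norm_num

theorem ennreal_add_sq_le (a b : ℝ≥0∞) : (a + b) ^ 2 ≤ 2 * a ^ 2 + 2 * b ^ 2 := by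
  have := ENNReal.rpow_add_le_mul_rpow_add_rpow a b (p := 2) (by norm_num)
  norm_num at this
  rwa [mul_add] at this

/-- Write `f b = f s + ∫ f'` over `[s, b]`, square, apply Cauchy-Schwarz to the integral and
integrate over `s`. -/
theorem enorm_sq_endpoint_le {f : ℝ → ℂ} (hf : ContDiff ℝ 1 f) (b δ : ℝ) :
    ENNReal.ofReal δ * ‖f b‖ₑ ^ 2 ≤ 2 * (∫⁻ s in Set.Ioo (b - δ) b, ‖f s‖ₑ ^ 2) +
      2 * ENNReal.ofReal δ ^ 2 * ∫⁻ s in Set.Ioo (b - δ) b, ‖deriv f s‖ₑ ^ 2 := by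
  have hv : volume (Set.Ioo (b - δ) b) = ENNReal.ofReal δ := by simp
  have hd : Continuous (deriv f) := hf.continuous_deriv le_rfl
  set T := ∫⁻ s in Set.Ioo (b - δ) b, ‖deriv f s‖ₑ with hT
  have hT2 : T ^ 2 ≤ ENNReal.ofReal δ * ∫⁻ s in Set.Ioo (b - δ) b, ‖deriv f s‖ₑ ^ 2 := by
    have := sq_lintegral_le (volume.restrict (Set.Ioo (b - δ) b)) (g := fun s => ‖deriv f s‖ₑ)
      hd.enorm.measurable.aemeasurable
    rwa [Measure.restrict_apply_univ, hv] at this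
  have hpt : ∀ s ∈ Set.Ioo (b - δ) b, ‖f b‖ₑ ^ 2 ≤ 2 * ‖f s‖ₑ ^ 2 + 2 * T ^ 2 := by
    intro s hs
    have h1 : f b = f s + ∫ x in s..b, deriv f x := by
      rw [intervalIntegral.integral_deriv_eq_sub
        (fun x _ => (hf.differentiable one_ne_zero).differentiableAt) (hd.intervalIntegrable _ _)]
      ring
    have h2 : ‖∫ x in s..b, deriv f x‖ₑ ≤ T := by
      rw [intervalIntegral.integral_of_le hs.2.le, integral_Ioc_eq_integral_Ioo]
      refine (enorm_integral_le_lintegral_enorm _).trans ?_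
      exact lintegral_mono_set (Set.Ioo_subset_Ioo_left hs.1.le)
    calc ‖f b‖ₑ ^ 2 ≤ (‖f s‖ₑ + T) ^ 2 := by
          gcongr
          rw [h1]
          exact (enorm_add_le _ _).trans (by gcongr)
      _ ≤ _ := ennreal_add_sq_le _ _
  calc ENNReal.ofReal δ * ‖f b‖ₑ ^ 2 = ∫⁻ s in Set.Ioo (b - δ) b, ‖f b‖ₑ ^ 2 := by
        rw [setLIntegral_const, hv, mul_comm]
    _ ≤ ∫⁻ s in Set.Ioo (b - δ) b, (2 * ‖f s‖ₑ ^ 2 + 2 * T ^ 2) :=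
        setLIntegral_mono (by have := hf.continuous; fun_prop) hpt
    _ = 2 * (∫⁻ s in Set.Ioo (b - δ) b, ‖f s‖ₑ ^ 2) + 2 * T ^ 2 * ENNReal.ofReal δ := by
        rw [lintegral_add_right _ measurable_const, lintegral_const_mul _ (by
          have := hf.continuous; fun_prop), setLIntegral_const, hv]
    _ ≤ 2 * (∫⁻ s in Set.Ioo (b - δ) b, ‖f s‖ₑ ^ 2) +
        2 * (ENNReal.ofReal δ * ∫⁻ s in Set.Ioo (b - δ) b, ‖deriv f s‖ₑ ^ 2) *
          ENNReal.ofReal δ := by gcongr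
    _ = _ := by ring

/-- The point of `ℝ³` with horizontal coordinates `x` and height `s`. -/
def cylinderPoint (p : EuclideanSpace ℝ (Fin 2) × ℝ) : Space := !₂[p.1 0, p.1 1, p.2]

theorem measurePreserving_cylinderPoint : MeasurePreserving cylinderPoint := by
  have h1 := ((volume_preserving_piFinSuccAbove (fun _ : Fin 3 => ℝ) 2).symm).comp
    (((MeasurePreserving.id (volume : Measure ℝ)).prod (PiLp.volume_preserving_ofLp (Fin 2))).comp
      Measure.measurePreserving_swap)
  have h2 := (PiLp.volume_preserving_toLp (Fin 3)).comp h1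
  refine (show cylinderPoint = _ from ?_) ▸ h2
  funext p
  ext i
  fin_cases i <;> rfl

theorem norm_cylinderPoint_sub_le (p q : EuclideanSpace ℝ (Fin 2) × ℝ) :
    ‖cylinderPoint p - cylinderPoint q‖ ≤ ‖p.1 - q.1‖ + |p.2 - q.2| := by
  have h : ‖cylinderPoint p - cylinderPoint q‖ ^ 2 = ‖p.1 - q.1‖ ^ 2 + |p.2 - q.2| ^ 2 := by
    rw [EuclideanSpace.real_norm_sq_eq, EuclideanSpace.real_norm_sq_eq, Fin.sum_univ_three,
      Fin.sum_univ_two, sq_abs]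
    rfl
  refine abs_le_of_sq_le_sq' ?_ (by positivity) |>.2
  rw [h]
  nlinarith [norm_nonneg (p.1 - q.1), abs_nonneg (p.2 - q.2),
    mul_nonneg (norm_nonneg (p.1 - q.1)) (abs_nonneg (p.2 - q.2))]

theorem cylinderPoint_add_smul (x : EuclideanSpace ℝ (Fin 2)) (s t : ℝ) :
    cylinderPoint (x, s + t) = cylinderPoint (x, s) + t • EuclideanSpace.single 2 1 := by
  ext i
  fin_cases i <;> simp [cylinderPoint]

theorem eq_cylinderPoint (y : Space) : y = cylinderPoint (!₂[y 0, y 1], y 2) := by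
  ext i
  fin_cases i <;> rfl

/-- The squared density of the `H¹` norm. -/
def energyDensity (w : Space → ℂ) (y : Space) : ℝ≥0∞ :=
  ‖w y‖ₑ ^ 2 + ∑ i, ‖partialDeriv i w y‖ₑ ^ 2

theorem continuous_partialDeriv {w : Space → ℂ} (hw : ContDiff ℝ ∞ w) (i : Fin 3) :
    Continuous (partialDeriv i w) :=
  (hw.continuous_fderiv (by simp)).clm_apply continuous_const

theorem measurable_energyDensity {w : Space → ℂ} (hw : ContDiff ℝ ∞ w) :
    Measurable (energyDensity w) := by
  unfold energyDensity
  refine (hw.continuous.enorm.measurable.pow_const 2).add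
    (Finset.measurable_fun_sum _ fun i _ => (continuous_partialDeriv hw i).enorm.measurable.pow_const 2)

theorem enorm_fderiv_sq_le (w : Space → ℂ) (y : Space) {a : Space} (ha : ‖a‖ ≤ 1) :
    ‖fderiv ℝ w y a‖ₑ ^ 2 ≤ 3 * ∑ i, ‖partialDeriv i w y‖ₑ ^ 2 := by
  have h1 : ‖fderiv ℝ w y a‖ ≤ ∑ i, ‖partialDeriv i w y‖ := by
    have : a = ∑ i, a i • EuclideanSpace.single i (1 : ℝ) := by
      ext j; simp [Finset.sum_apply, Pi.single_apply]
    conv_lhs => rw [this, map_sum]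
    refine (norm_sum_le _ _).trans (Finset.sum_le_sum fun i _ => ?_)
    rw [map_smul, norm_smul]
    exact mul_le_of_le_one_left (norm_nonneg _) ((PiLp.norm_apply_le a i).trans ha)
  have h2 : ‖fderiv ℝ w y a‖ ^ 2 ≤ 3 * ∑ i, ‖partialDeriv i w y‖ ^ 2 := by
    refine (pow_le_pow_left₀ (norm_nonneg _) h1 2).trans ?_
    have := sq_sum_le_card_mul_sum_sq (s := Finset.univ) (f := fun i : Fin 3 => ‖partialDeriv i w y‖)
    simpa using this
  have h3 := ENNReal.ofReal_le_ofReal h2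
  rw [ENNReal.ofReal_pow (norm_nonneg _), ENNReal.ofReal_mul (by norm_num),
    ENNReal.ofReal_sum_of_nonneg (fun i _ => by positivity), ofReal_norm] at h3
  simpa [ENNReal.ofReal_pow, ofReal_norm] using h3

/-- A boundary point of the open set `D` is not in `D`, so it is not below the graph. Strictly above
the graph it would have a neighbourhood missing `D`. -/
theorem frontier_inter_ball_subset_graph {D : Set Space} (hD : IsOpen D) {x : Space} {r : ℝ}
    {e : Space ≃ₗᵢ[ℝ] Space} {γ : EuclideanSpace ℝ (Fin 2) → ℝ} (hγ : Continuous γ)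
    (h : ∀ y ∈ Metric.ball x r, y ∈ D ↔ (e y) 2 < γ !₂[(e y) 0, (e y) 1]) {y : Space}
    (hy : y ∈ frontier D) (hyr : y ∈ Metric.ball x r) :
    (e y) 2 = γ !₂[(e y) 0, (e y) 1] := by
  rw [hD.frontier_eq] at hy
  refine le_antisymm ?_ (not_lt.1 fun hlt => hy.2 ((h y hyr).2 hlt))
  by_contra! hgt
  have hcont : Continuous fun z : Space => γ !₂[(e z) 0, (e z) 1] := hγ.comp (by fun_prop)
  have hopen : IsOpen {z : Space | γ !₂[(e z) 0, (e z) 1] < (e z) 2} :=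
    isOpen_lt hcont (by fun_prop)
  obtain ⟨z, ⟨hz1, hz2⟩, hz3⟩ := mem_closure_iff.1 hy.1 _ (hopen.inter Metric.isOpen_ball) ⟨hgt, hyr⟩
  exact lt_asymm hz1 ((h z hz2).1 hz3)

/-- Below each boundary point near `x` hangs a segment of fixed length inside `D`. The endpoint
estimate on these segments, integrated over the base plane, is the claim by Fubini. -/
theorem exists_local_trace_bound {D : Set Space} (hD : IsOpen D) {x : Space} {r : ℝ} (hr : 0 < r)
    (e : Space ≃ₗᵢ[ℝ] Space) {K : NNReal} {γ : EuclideanSpace ℝ (Fin 2) → ℝ}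
    (hγ : LipschitzWith K γ)
    (h : ∀ y ∈ Metric.ball x r, y ∈ D ↔ (e y) 2 < γ !₂[(e y) 0, (e y) 1]) :
    ∃ M : ℝ≥0∞, M ≠ ⊤ ∧ ∀ w : Space → ℂ, ContDiff ℝ ∞ w →
      ∫⁻ y in frontier D ∩ Metric.ball x (r / 2), ‖w y‖ₑ ^ 2 ∂(Measure.euclideanHausdorffMeasure 2) ≤
        M * ∫⁻ y in D, energyDensity w y := by
  set Ψ : EuclideanSpace ℝ (Fin 2) × ℝ → Space := fun p => e.symm (cylinderPoint p) with hΨ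
  have hΨmp : MeasurePreserving Ψ := e.symm.measurePreserving.comp measurePreserving_cylinderPoint
  set G : EuclideanSpace ℝ (Fin 2) → Space := fun x' => Ψ (x', γ x') with hGdef
  have hG : LipschitzWith (1 + K) G := by
    refine LipschitzWith.of_dist_le_mul fun a b => ?_
    rw [hGdef, hΨ, e.symm.dist_map, dist_eq_norm]
    refine (norm_cylinderPoint_sub_le _ _).trans ?_
    have := hγ.dist_le_mul a b
    rw [Real.dist_eq] at this
    rw [← dist_eq_norm]
    push_cast
    linarith
  -- Half the radius: a segment of length `δ` starting within `δ` of `x` stays in the ball where the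
  -- graph describes `D`.
  set δ := r / 2 with hδ
  have hδ0 : 0 < δ := by positivity
  set S := G ⁻¹' Metric.ball x δ with hS
  have hSm : MeasurableSet S := hG.continuous.measurable Metric.isOpen_ball.measurableSet
  have hsub : frontier D ∩ Metric.ball x δ ⊆ G '' S := by
    rintro y ⟨hy, hyb⟩
    have hg := frontier_inter_ball_subset_graph hD hγ.continuous h hy
      (Metric.ball_subset_ball (by linarith) hyb)
    have hGy : G !₂[(e y) 0, (e y) 1] = y := by
      simp only [hGdef, hΨ, ← hg, ← eq_cylinderPoint, e.symm_apply_apply]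
    exact ⟨_, by simpa only [hS, Set.mem_preimage, hGy] using hyb, hGy⟩
  have hline : ∀ x' s t, Ψ (x', s + t) = Ψ (x', s) + t • e.symm (EuclideanSpace.single 2 1) := by
    intro x' s t
    simp only [hΨ, cylinderPoint_add_smul, map_add, map_smul]
  have hin : ∀ x' ∈ S, ∀ s ∈ Set.Ioo (γ x' - δ) (γ x'), Ψ (x', s) ∈ D := by
    intro x' hx' s hs
    have hb : Ψ (x', s) ∈ Metric.ball x r := by
      have h1 : Ψ (x', s) = G x' + (s - γ x') • e.symm (EuclideanSpace.single 2 1) := by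
        rw [hGdef, ← hline]; congr 2; ring
      have h2 : dist (Ψ (x', s)) (G x') ≤ δ := by
        rw [h1, dist_eq_norm, add_sub_cancel_left, norm_smul, e.symm.norm_map, Real.norm_eq_abs,
          abs_of_neg (by linarith [hs.2])]
        simp
        linarith [hs.1]
      have h3 : dist (G x') x < δ := hx'
      rw [Metric.mem_ball]
      linarith [dist_triangle (Ψ (x', s)) (G x') x]
    refine (h _ hb).2 ?_
    have : e (Ψ (x', s)) = cylinderPoint (x', s) := by simp [hΨ]
    rw [this]
    have h4 : (!₂[(cylinderPoint (x', s)) 0, (cylinderPoint (x', s)) 1] : EuclideanSpace ℝ (Fin 2))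
        = x' := by
      ext i; fin_cases i <;> rfl
    rw [h4]
    exact hs.2
  -- The 2 and the factor `2 δ²` come from the endpoint estimate; a further factor 3 comes from
  -- bounding a directional derivative by the three partials.
  set c : ℝ≥0∞ := 2 + 6 * ENNReal.ofReal δ ^ 2 with hc
  refine ⟨((1 + K : NNReal) : ℝ≥0∞) ^ 2 * ((ENNReal.ofReal δ)⁻¹ * c), ?_, fun w hw => ?_⟩
  · have : (ENNReal.ofReal δ)⁻¹ ≠ ⊤ := by simpa using hδ0
    have h2 : c ≠ ⊤ := by simp [hc, ENNReal.mul_eq_top]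
    exact ENNReal.mul_ne_top (by simp) (ENNReal.mul_ne_top this h2)
  have hwm : Measurable fun y => ‖w y‖ₑ ^ 2 := hw.continuous.enorm.measurable.pow_const 2
  have hEm := measurable_energyDensity hw
  -- With the indicator of `D`, the segment can be enlarged to the whole vertical line, so that
  -- Fubini yields an integral over `D`.
  have hfib : ∀ x' ∈ S, ‖w (G x')‖ₑ ^ 2 ≤ (ENNReal.ofReal δ)⁻¹ * (c *
      ∫⁻ s, D.indicator (energyDensity w) (Ψ (x', s))) := by
    intro x' hx'
    set f : ℝ → ℂ := fun s => w (Ψ (x', s)) with hf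
    have hΨ' : ∀ s, Ψ (x', s) = Ψ (x', 0) + s • e.symm (EuclideanSpace.single 2 1) := by
      intro s; rw [← hline, zero_add]
    have hfc : ContDiff ℝ 1 f := by
      have : f = fun s => w (Ψ (x', 0) + s • e.symm (EuclideanSpace.single 2 1)) := by
        funext s; rw [hf, ← hΨ']
      rw [this]
      exact (hw.of_le (by simp)).comp (by fun_prop)
    have hder : ∀ s, deriv f s = fderiv ℝ w (Ψ (x', s)) (e.symm (EuclideanSpace.single 2 1)) := by
      intro s
      have h1 : HasDerivAt (fun s => Ψ (x', s)) (e.symm (EuclideanSpace.single 2 1)) s := by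
        have := ((hasDerivAt_id s).smul_const (e.symm (EuclideanSpace.single 2 (1 : ℝ)))).const_add
          (Ψ (x', 0))
        rw [one_smul] at this
        refine this.congr_of_eventuallyEq (Eventually.of_forall fun t => ?_)
        exact hΨ' t
      exact ((hw.differentiable (by simp)).differentiableAt.hasFDerivAt.comp_hasDerivAt s h1).deriv
    rw [← ENNReal.mul_le_iff_le_inv (by simpa using hδ0) ENNReal.ofReal_ne_top]
    have hfm : Measurable fun s => ‖deriv f s‖ₑ ^ 2 :=
      (hfc.continuous_deriv le_rfl).enorm.measurable.pow_const 2
    have hfm' : Measurable fun s => ‖f s‖ₑ ^ 2 := hfc.continuous.enorm.measurable.pow_const 2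
    calc _ ≤ _ := enorm_sq_endpoint_le hfc (γ x') δ
      _ = ∫⁻ s in Set.Ioo (γ x' - δ) (γ x'),
          (2 * ‖f s‖ₑ ^ 2 + 2 * ENNReal.ofReal δ ^ 2 * ‖deriv f s‖ₑ ^ 2) := by
        rw [lintegral_add_left (hfm'.const_mul _), lintegral_const_mul _ hfm',
          lintegral_const_mul _ hfm]
      _ ≤ ∫⁻ s in Set.Ioo (γ x' - δ) (γ x'), c * D.indicator (energyDensity w) (Ψ (x', s)) := by
        refine setLIntegral_mono' measurableSet_Ioo fun s hs => ?_
        rw [Set.indicator_of_mem (hin x' hx' s hs), hder, energyDensity, hc]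
        have h1 := enorm_fderiv_sq_le w (Ψ (x', s)) (a := e.symm (EuclideanSpace.single 2 1))
          (by simp)
        calc _ ≤ 2 * ‖w (Ψ (x', s))‖ₑ ^ 2 + 2 * ENNReal.ofReal δ ^ 2 *
              (3 * ∑ i, ‖partialDeriv i w (Ψ (x', s))‖ₑ ^ 2) := by gcongr
          _ = 2 * ‖w (Ψ (x', s))‖ₑ ^ 2 + 6 * ENNReal.ofReal δ ^ 2 *
              ∑ i, ‖partialDeriv i w (Ψ (x', s))‖ₑ ^ 2 := by ring
          _ ≤ (2 + 6 * ENNReal.ofReal δ ^ 2) * ‖w (Ψ (x', s))‖ₑ ^ 2 +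
              (2 + 6 * ENNReal.ofReal δ ^ 2) * ∑ i, ‖partialDeriv i w (Ψ (x', s))‖ₑ ^ 2 := by
            gcongr
            · exact le_self_add
            · exact le_add_self
          _ = _ := by ring
      _ ≤ ∫⁻ s, c * D.indicator (energyDensity w) (Ψ (x', s)) := setLIntegral_le_lintegral _ _
      _ = _ := lintegral_const_mul _ (((hEm.indicator hD.measurableSet).comp hΨmp.measurable).comp
          (by fun_prop))
  calc _ ≤ ∫⁻ y in G '' S, ‖w y‖ₑ ^ 2 ∂(Measure.euclideanHausdorffMeasure 2) :=
        lintegral_mono_set hsub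
    _ ≤ ((1 + K : NNReal) : ℝ≥0∞) ^ 2 * ∫⁻ x' in S, ‖w (G x')‖ₑ ^ 2 :=
        setLIntegral_image_euclideanHausdorffMeasure_le hG S hwm
    _ ≤ ((1 + K : NNReal) : ℝ≥0∞) ^ 2 * ((ENNReal.ofReal δ)⁻¹ * (c * ∫⁻ y in D, energyDensity w y)) := by
        gcongr
        have hind : Measurable fun p => D.indicator (energyDensity w) (Ψ p) :=
          (hEm.indicator hD.measurableSet).comp hΨmp.measurable
        calc _ ≤ ∫⁻ x' in S, (ENNReal.ofReal δ)⁻¹ * (c *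
              ∫⁻ s, D.indicator (energyDensity w) (Ψ (x', s))) :=
              setLIntegral_mono' hSm hfib
          _ ≤ ∫⁻ x', (ENNReal.ofReal δ)⁻¹ * (c *
              ∫⁻ s, D.indicator (energyDensity w) (Ψ (x', s))) := setLIntegral_le_lintegral _ _
          _ = _ := by
            rw [lintegral_const_mul _ (hind.lintegral_prod_right'.const_mul _),
              lintegral_const_mul _ hind.lintegral_prod_right',
              ← lintegral_prod _ hind.aemeasurable, ← lintegral_indicator hD.measurableSet,
              ← hΨmp.lintegral_comp (hEm.indicator hD.measurableSet)]
            rfl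
    _ = _ := by ring

/-- Having a bound over `frontier Ω.D ∩ S` passes to subsets and unions of `S`, so the local bounds
extend to the compact boundary. -/
theorem exists_trace_bound_of_contDiff (Ω : AcousticDomain) :
    ∃ M : ℝ≥0∞, M ≠ ⊤ ∧ ∀ w : Space → ℂ, ContDiff ℝ ∞ w →
      ∫⁻ y, ‖w y‖ₑ ^ 2 ∂(surfaceMeasure Ω.D) ≤ M * ∫⁻ y in Ω.D, energyDensity w y := by
  have hc : IsCompact (frontier Ω.D) :=
    Metric.isCompact_of_isClosed_isBounded isClosed_frontier
      (Ω.isBounded.closure.subset frontier_subset_closure)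
  have key : ∃ M : ℝ≥0∞, M ≠ ⊤ ∧ ∀ w : Space → ℂ, ContDiff ℝ ∞ w →
      ∫⁻ y in frontier Ω.D ∩ frontier Ω.D, ‖w y‖ₑ ^ 2 ∂(Measure.euclideanHausdorffMeasure 2) ≤
        M * ∫⁻ y in Ω.D, energyDensity w y := by
    refine hc.induction_on (p := fun S => ∃ M : ℝ≥0∞, M ≠ ⊤ ∧ ∀ w : Space → ℂ, ContDiff ℝ ∞ w →
      ∫⁻ y in frontier Ω.D ∩ S, ‖w y‖ₑ ^ 2 ∂(Measure.euclideanHausdorffMeasure 2) ≤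
        M * ∫⁻ y in Ω.D, energyDensity w y) ⟨0, by simp, by simp⟩ ?_ ?_ ?_
    · rintro s t hst ⟨M, hM, h⟩
      exact ⟨M, hM, fun w hw => (lintegral_mono_set (Set.inter_subset_inter_right _ hst)).trans
        (h w hw)⟩
    · rintro s t ⟨M, hM, h⟩ ⟨M', hM', h'⟩
      refine ⟨M + M', ENNReal.add_ne_top.2 ⟨hM, hM'⟩, fun w hw => ?_⟩
      rw [Set.inter_union_distrib_left, add_mul]
      exact (lintegral_union_le _ _ _).trans (add_le_add (h w hw) (h' w hw))
    · intro x hx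
      obtain ⟨r, e, K, γ, hr, hγ, hD⟩ := Ω.lipschitz x hx
      exact ⟨_, mem_nhdsWithin_of_mem_nhds (Metric.ball_mem_nhds x (half_pos hr)),
        exists_local_trace_bound Ω.isOpen hr e hγ hD⟩
  simpa only [Set.inter_self, surfaceMeasure] using key

theorem eLpNorm_two_sq {α F : Type*} [MeasurableSpace α] [NormedAddCommGroup F] (μ : Measure α)
    (f : α → F) : eLpNorm f 2 μ ^ 2 = ∫⁻ x, ‖f x‖ₑ ^ 2 ∂μ := by
  have := eLpNorm_nnreal_pow_eq_lintegral (μ := μ) (f := f) (p := 2) (by norm_num)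
  simpa using this

theorem lintegral_energyDensity {D : Set Space} {w : Space → ℂ} (hw : ContDiff ℝ ∞ w) :
    ∫⁻ y in D, energyDensity w y = eLpNorm w 2 (volume.restrict D) ^ 2 +
      ∑ i, eLpNorm (partialDeriv i w) 2 (volume.restrict D) ^ 2 := by
  simp only [eLpNorm_two_sq, energyDensity]
  have h : ∀ i, Measurable fun y => ‖partialDeriv i w y‖ₑ ^ 2 := fun i =>
    (continuous_partialDeriv hw i).enorm.measurable.pow_const 2
  rw [lintegral_add_right _ (Finset.measurable_fun_sum _ fun i _ => h i),
    lintegral_finsetSum _ fun i _ => h i]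

/-! ### Boundedness, linearity and uniqueness of traces. -/

section Trace

variable {D : Set Space}

theorem H1.norm_fn_le (u : H1 D) : ‖u.fn‖ ≤ ‖u‖ := WithLp.norm_fst_le _ u.1

theorem H1.norm_grad_le (u : H1 D) : ‖u.grad‖ ≤ ‖u‖ := WithLp.norm_snd_le _ u.1

theorem aestronglyMeasurable_grad_apply (u : H1 D) (i : Fin 3) :
    AEStronglyMeasurable (fun x => u.grad x i) (volume.restrict D) :=
  (EuclideanSpace.proj (𝕜 := ℂ) i).continuous.comp_aestronglyMeasurable
    (Lp.aestronglyMeasurable u.grad)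

theorem eLpNorm_fn_le (u : H1 D) : eLpNorm u.fn 2 (volume.restrict D) ≤ ‖u‖ₑ := by
  rw [← Lp.enorm_def, enorm_le_iff_norm_le]
  exact u.norm_fn_le

theorem eLpNorm_grad_apply_le (u : H1 D) (i : Fin 3) :
    eLpNorm (fun x => u.grad x i) 2 (volume.restrict D) ≤ ‖u‖ₑ := by
  refine (eLpNorm_mono fun x => PiLp.norm_apply_le (u.grad x) i).trans ?_
  rw [← Lp.enorm_def, enorm_le_iff_norm_le]
  exact u.norm_grad_le

theorem eLpNorm_le_of_sub {α : Type*} [MeasurableSpace α] {μ : Measure α} {f g : α → ℂ}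
    (hf : AEStronglyMeasurable f μ) (hg : AEStronglyMeasurable g μ) :
    eLpNorm f 2 μ ≤ eLpNorm (fun x => f x - g x) 2 μ + eLpNorm g 2 μ := by
  have := eLpNorm_add_le (hf.sub hg) hg (p := 2) (by norm_num)
  rw [sub_add_cancel] at this
  exact this

/-- The smooth inequality is applied to the approximants in the definition of `IsTrace`, and the
limit is taken. -/
theorem exists_trace_bound (Ω : AcousticDomain) :
    ∃ C : ℝ, 0 ≤ C ∧ ∀ (u : H1 Ω.D) t, IsTrace u t → ‖t‖ ≤ C * ‖u‖ := by
  obtain ⟨M, hM, h⟩ := exists_trace_bound_of_contDiff Ω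
  refine ⟨√(8 * M.toReal), Real.sqrt_nonneg _, fun u t ⟨w, hw, h0, h1, ht⟩ => ?_⟩
  set a := fun n => eLpNorm (fun x => w n x - u.fn x) 2 (volume.restrict Ω.D)
  set b := fun i n => eLpNorm (fun x => partialDeriv i (w n) x - u.grad x i) 2 (volume.restrict Ω.D)
  set e := fun n => eLpNorm (fun x => w n x - t x) 2 (surfaceMeasure Ω.D)
  have hbound : ∀ n, ‖t‖ₑ ^ 2 ≤ 2 * e n ^ 2 + 2 * (M * ((a n + ‖u‖ₑ) ^ 2 +
      ∑ i, (b i n + ‖u‖ₑ) ^ 2)) := by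
    intro n
    have hwm : ∀ μ : Measure Space, AEStronglyMeasurable (w n) μ := fun μ =>
      (hw n).continuous.aestronglyMeasurable
    have e1 : ‖t‖ₑ ≤ e n + eLpNorm (w n) 2 (surfaceMeasure Ω.D) := by
      rw [Lp.enorm_def]
      refine (eLpNorm_le_of_sub (Lp.aestronglyMeasurable t) (hwm _)).trans_eq ?_
      congr 1
      exact eLpNorm_sub_comm _ _ _ _
    have e2 : eLpNorm (w n) 2 (surfaceMeasure Ω.D) ^ 2 ≤
        M * ((a n + ‖u‖ₑ) ^ 2 + ∑ i, (b i n + ‖u‖ₑ) ^ 2) := by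
      rw [eLpNorm_two_sq]
      refine (h _ (hw n)).trans ?_
      rw [lintegral_energyDensity (hw n)]
      gcongr with i
      · exact (eLpNorm_le_of_sub (hwm _) (Lp.aestronglyMeasurable u.fn)).trans
          (by gcongr; exact eLpNorm_fn_le u)
      · exact (eLpNorm_le_of_sub (continuous_partialDeriv (hw n) i).aestronglyMeasurable
          (aestronglyMeasurable_grad_apply u i)).trans (by gcongr; exact eLpNorm_grad_apply_le u i)
    calc ‖t‖ₑ ^ 2 ≤ _ := pow_le_pow_left' e1 2
      _ ≤ _ := ennreal_add_sq_le _ _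
      _ ≤ _ := by gcongr
  have hlim : Tendsto (fun n => 2 * e n ^ 2 + 2 * (M * ((a n + ‖u‖ₑ) ^ 2 +
      ∑ i, (b i n + ‖u‖ₑ) ^ 2))) atTop
      (𝓝 (2 * 0 ^ 2 + 2 * (M * ((0 + ‖u‖ₑ) ^ 2 + ∑ i : Fin 3, (0 + ‖u‖ₑ) ^ 2)))) := by
    refine (ENNReal.Tendsto.const_mul (ENNReal.Tendsto.pow (n := 2) ht) (by simp)).add
      (ENNReal.Tendsto.const_mul (ENNReal.Tendsto.const_mul
        ((ENNReal.Tendsto.pow (n := 2) (h0.add tendsto_const_nhds)).add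
          (tendsto_finsetSum _ fun i _ => ENNReal.Tendsto.pow (n := 2) ((h1 i).add tendsto_const_nhds)))
        (Or.inr hM)) (by simp))
  have hfin := ge_of_tendsto' hlim hbound
  have hsq : ‖t‖ ^ 2 ≤ 8 * M.toReal * ‖u‖ ^ 2 := by
    -- Here 8 is `2 (1 + 3)`: the function and the three partials are each bounded by the full `H¹`
    -- norm.
    have h8 : 2 * 0 ^ 2 + 2 * (M * ((0 + ‖u‖ₑ) ^ 2 + ∑ i : Fin 3, (0 + ‖u‖ₑ) ^ 2)) =
        8 * M * ‖u‖ₑ ^ 2 := by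
      simp; ring
    rw [h8] at hfin
    have := ENNReal.toReal_mono (by simp [ENNReal.mul_eq_top, hM]) hfin
    simpa using this
  refine abs_le_of_sq_le_sq' ?_ (by positivity) |>.2
  rwa [mul_pow, Real.sq_sqrt (by positivity)]

theorem partialDeriv_add {w v : Space → ℂ} (hw : ContDiff ℝ ∞ w) (hv : ContDiff ℝ ∞ v) (i : Fin 3)
    (x : Space) : partialDeriv i (w + v) x = partialDeriv i w x + partialDeriv i v x := by
  simp only [partialDeriv]
  rw [fderiv_add ((hw.differentiable (by simp)) x) ((hv.differentiable (by simp)) x)]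
  rfl

theorem partialDeriv_const_smul {w : Space → ℂ} (hw : ContDiff ℝ ∞ w) (c : ℂ) (i : Fin 3)
    (x : Space) : partialDeriv i (c • w) x = c * partialDeriv i w x := by
  simp only [partialDeriv]
  rw [fderiv_const_smul ((hw.differentiable (by simp)) x)]
  rfl

theorem tendsto_eLpNorm_zero_add {α : Type*} [MeasurableSpace α] {μ : Measure α}
    {f g : ℕ → α → ℂ} {k : ℕ → α → ℂ}
    (hf : ∀ n, AEStronglyMeasurable (f n) μ) (hg : ∀ n, AEStronglyMeasurable (g n) μ)
    (hk : ∀ n, k n =ᵐ[μ] f n + g n)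
    (hf0 : Tendsto (fun n => eLpNorm (f n) 2 μ) atTop (𝓝 0))
    (hg0 : Tendsto (fun n => eLpNorm (g n) 2 μ) atTop (𝓝 0)) :
    Tendsto (fun n => eLpNorm (k n) 2 μ) atTop (𝓝 0) := by
  have h := hf0.add hg0
  rw [add_zero] at h
  refine tendsto_of_tendsto_of_tendsto_of_le_of_le tendsto_const_nhds h (fun _ => zero_le) fun n => ?_
  simp only
  rw [eLpNorm_congr_ae (hk n)]
  exact eLpNorm_add_le (hf n) (hg n) (by norm_num)

theorem tendsto_eLpNorm_zero_const_smul {α : Type*} [MeasurableSpace α] {μ : Measure α}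
    {f k : ℕ → α → ℂ} (c : ℂ) (hk : ∀ n, k n =ᵐ[μ] c • f n)
    (hf0 : Tendsto (fun n => eLpNorm (f n) 2 μ) atTop (𝓝 0)) :
    Tendsto (fun n => eLpNorm (k n) 2 μ) atTop (𝓝 0) := by
  have h := ENNReal.Tendsto.const_mul (a := ‖c‖ₑ) hf0 (by simp)
  rw [mul_zero] at h
  refine h.congr fun n => ?_
  rw [eLpNorm_congr_ae (hk n), eLpNorm_const_smul]

theorem IsTrace.add {u v : H1 D} {s t : Lp ℂ 2 (surfaceMeasure D)} (hu : IsTrace u s)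
    (hv : IsTrace v t) : IsTrace (u + v) (s + t) := by
  obtain ⟨w, hw, h0, h1, h2⟩ := hu
  obtain ⟨w', hw', h0', h1', h2'⟩ := hv
  refine ⟨fun n => w n + w' n, fun n => (hw n).add (hw' n), ?_, fun i => ?_, ?_⟩
  · refine tendsto_eLpNorm_zero_add
      (fun n => (hw n).continuous.aestronglyMeasurable.sub (Lp.aestronglyMeasurable _))
      (fun n => (hw' n).continuous.aestronglyMeasurable.sub (Lp.aestronglyMeasurable _))
      (fun n => ?_) h0 h0'
    filter_upwards [Lp.coeFn_add u.fn v.fn] with x hx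
    rw [show (u + v).fn = u.fn + v.fn from rfl, hx]
    simp only [Pi.add_apply, Pi.sub_apply]
    ring
  · refine tendsto_eLpNorm_zero_add
      (fun n => (continuous_partialDeriv (hw n) i).aestronglyMeasurable.sub
        (aestronglyMeasurable_grad_apply u i))
      (fun n => (continuous_partialDeriv (hw' n) i).aestronglyMeasurable.sub
        (aestronglyMeasurable_grad_apply v i))
      (fun n => ?_) (h1 i) (h1' i)
    filter_upwards [Lp.coeFn_add u.grad v.grad] with x hx
    rw [show (u + v).grad = u.grad + v.grad from rfl, hx, partialDeriv_add (hw n) (hw' n)]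
    simp only [Pi.add_apply, PiLp.add_apply, Pi.sub_apply]
    ring
  · refine tendsto_eLpNorm_zero_add
      (fun n => (hw n).continuous.aestronglyMeasurable.sub (Lp.aestronglyMeasurable _))
      (fun n => (hw' n).continuous.aestronglyMeasurable.sub (Lp.aestronglyMeasurable _))
      (fun n => ?_) h2 h2'
    filter_upwards [Lp.coeFn_add s t] with x hx
    rw [hx]
    simp only [Pi.add_apply, Pi.sub_apply]
    ring

theorem IsTrace.smul {u : H1 D} {t : Lp ℂ 2 (surfaceMeasure D)} (c : ℂ) (hu : IsTrace u t) :
    IsTrace (c • u) (c • t) := by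
  obtain ⟨w, hw, h0, h1, h2⟩ := hu
  refine ⟨fun n => c • w n, fun n => contDiff_const.smul (hw n), ?_, fun i => ?_, ?_⟩
  · refine tendsto_eLpNorm_zero_const_smul c (fun n => ?_) h0
    filter_upwards [Lp.coeFn_smul c u.fn] with x hx
    rw [show (c • u).fn = c • u.fn from rfl, hx]
    simp only [Pi.smul_apply, smul_eq_mul]
    ring
  · refine tendsto_eLpNorm_zero_const_smul c (fun n => ?_) (h1 i)
    filter_upwards [Lp.coeFn_smul c u.grad] with x hx
    rw [show (c • u).grad = c • u.grad from rfl, hx, partialDeriv_const_smul (hw n)]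
    simp only [Pi.smul_apply, PiLp.smul_apply, smul_eq_mul]
    ring
  · refine tendsto_eLpNorm_zero_const_smul c (fun n => ?_) h2
    filter_upwards [Lp.coeFn_smul c t] with x hx
    rw [hx]
    simp only [Pi.smul_apply, smul_eq_mul]
    ring

/-- By linearity `s - t` is a trace of zero, so the bound makes it vanish. -/
theorem IsTrace.unique {Ω : AcousticDomain} {u : H1 Ω.D} {s t : Lp ℂ 2 (surfaceMeasure Ω.D)}
    (hs : IsTrace u s) (ht : IsTrace u t) : s = t := by
  obtain ⟨C, -, hC⟩ := exists_trace_bound Ω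
  have h := hC _ _ (hs.add (ht.smul (-1)))
  rw [neg_one_smul, neg_one_smul, add_neg_cancel, norm_zero, mul_zero, ← sub_eq_add_neg] at h
  exact sub_eq_zero.1 (norm_le_zero_iff.1 h)

theorem IsTrace.trace_eq {Ω : AcousticDomain} {u : H1 Ω.D} {t : Lp ℂ 2 (surfaceMeasure Ω.D)}
    (ht : IsTrace u t) : trace u = t := by
  have h : ∃ t, IsTrace u t := ⟨t, ht⟩
  rw [trace, dif_pos h]
  exact h.choose_spec.unique ht

end Trace

/-! ### Continuity of the Helmholtz form. -/

/-- `u` has a boundary trace. -/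
def HasTrace {D : Set Space} (u : H1 D) : Prop := ∃ t, IsTrace u t

theorem HasTrace.of_mem_V0 {Ω : AcousticDomain} {u : H1 Ω.D} (hu : u ∈ V0 Ω) : HasTrace u :=
  let ⟨t, ht, _⟩ := hu
  ⟨t, ht⟩

theorem HasTrace.sub {D : Set Space} {u v : H1 D} (hu : HasTrace u) (hv : HasTrace v) :
    HasTrace (u - v) := by
  obtain ⟨s, hs⟩ := hu
  obtain ⟨t, ht⟩ := hv
  refine ⟨s + (-1 : ℂ) • t, ?_⟩
  rw [sub_eq_add_neg, ← neg_one_smul ℂ]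
  exact hs.add (ht.smul (-1))

/-- Both hypotheses matter, because `trace` takes the default value 0 where no trace exists. -/
theorem trace_sub {Ω : AcousticDomain} {u v : H1 Ω.D} (hu : HasTrace u) (hv : HasTrace v) :
    trace (u - v) = trace u - trace v := by
  obtain ⟨s, hs⟩ := hu
  obtain ⟨t, ht⟩ := hv
  have h := (hs.add (ht.smul (-1))).trace_eq
  rw [neg_one_smul, neg_one_smul, ← sub_eq_add_neg, ← sub_eq_add_neg] at h
  rw [h, hs.trace_eq, ht.trace_eq]

/-- As an inner product in `L²(Γᵢ)`, the boundary term gets additivity and Cauchy-Schwarz without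
integrability arguments. -/
theorem boundaryInner_eq_inner (Ω : AcousticDomain) (i : Fin 5) (u v : H1 Ω.D) :
    boundaryInner Ω i u v =
      inner ℂ (LpToLpRestrictCLM Space ℂ ℂ (surfaceMeasure Ω.D) 2 (Ω.Γ i) (trace v))
        (LpToLpRestrictCLM Space ℂ ℂ (surfaceMeasure Ω.D) 2 (Ω.Γ i) (trace u)) := by
  rw [L2.inner_def, boundaryInner]
  refine integral_congr_ae ?_
  filter_upwards [LpToLpRestrictCLM_coeFn ℂ (Ω.Γ i) (trace u),
    LpToLpRestrictCLM_coeFn ℂ (Ω.Γ i) (trace v)] with x hu hv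
  rw [hu, hv, RCLike.inner_apply]

theorem boundaryInner_sub_left {Ω : AcousticDomain} (i : Fin 5) {u v : H1 Ω.D} (w : H1 Ω.D)
    (hu : HasTrace u) (hv : HasTrace v) :
    boundaryInner Ω i (u - v) w = boundaryInner Ω i u w - boundaryInner Ω i v w := by
  simp only [boundaryInner_eq_inner, trace_sub hu hv, map_sub, inner_sub_right]

theorem norm_boundaryInner_le (Ω : AcousticDomain) (i : Fin 5) (u v : H1 Ω.D) :
    ‖boundaryInner Ω i u v‖ ≤ ‖trace u‖ * ‖trace v‖ := by
  rw [boundaryInner_eq_inner, mul_comm]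
  exact (norm_inner_le_norm _ _).trans (mul_le_mul (norm_Lp_toLp_restrict_le _ _)
    (norm_Lp_toLp_restrict_le _ _) (norm_nonneg _) (norm_nonneg _))

theorem helmholtzForm_sub_left {Ω : AcousticDomain} (ν : Param) {u v : H1 Ω.D} (w : H1 Ω.D)
    (hu : HasTrace u) (hv : HasTrace v) :
    helmholtzForm Ω ν (u - v) w = helmholtzForm Ω ν u w - helmholtzForm Ω ν v w := by
  simp only [helmholtzForm, boundaryInner_sub_left _ _ hu hv,
    show (u - v).grad = u.grad - v.grad from rfl, show (u - v).fn = u.fn - v.fn from rfl,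
    inner_sub_right]
  ring

/-- A bound for the Helmholtz form when the trace operator is bounded by `T`. -/
def continuityConstant (T : ℝ) (s : ℝ × ℂ) : ℝ :=
  1 + s.1 ^ 2 + (|s.1| / ‖s.2‖ + |s.1|) * T ^ 2

theorem continuityConstant_pos (T : ℝ) (s : ℝ × ℂ) : 0 < continuityConstant T s := by
  unfold continuityConstant
  positivity

theorem continuousOn_continuityConstant (T : ℝ) :
    ContinuousOn (continuityConstant T) admissible := by
  have h : ∀ s ∈ admissible, ‖s.2‖ ≠ 0 := by
    rintro s ⟨-, hs⟩ h0
    rw [norm_eq_zero.1 h0] at hs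
    simp at hs
  unfold continuityConstant
  fun_prop (disch := assumption)

theorem norm_helmholtzForm_le {Ω : AcousticDomain} {T : ℝ}
    (hT : ∀ (u : H1 Ω.D) t, IsTrace u t → ‖t‖ ≤ T * ‖u‖) (ν : Param) {u v : H1 Ω.D}
    (hu : HasTrace u) (hv : HasTrace v) :
    ‖helmholtzForm Ω ν u v‖ ≤ continuityConstant T ν.kξ * (‖u‖ * ‖v‖) := by
  have htr : ∀ i, ‖boundaryInner Ω i u v‖ ≤ T ^ 2 * (‖u‖ * ‖v‖) := by
    intro i
    obtain ⟨s, hs⟩ := hu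
    obtain ⟨t, ht⟩ := hv
    refine (norm_boundaryInner_le Ω i u v).trans ?_
    rw [hs.trace_eq, ht.trace_eq]
    calc ‖s‖ * ‖t‖ ≤ (T * ‖u‖) * (T * ‖v‖) :=
          mul_le_mul (hT _ _ hs) (hT _ _ ht) (norm_nonneg _) ((norm_nonneg _).trans (hT _ _ hs))
      _ = _ := by ring
  have h1 : ‖inner ℂ v.grad u.grad‖ ≤ ‖u‖ * ‖v‖ := by
    rw [mul_comm]
    exact (norm_inner_le_norm _ _).trans
      (mul_le_mul v.norm_grad_le u.norm_grad_le (norm_nonneg _) (norm_nonneg _))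
  have h2 : ‖inner ℂ v.fn u.fn‖ ≤ ‖u‖ * ‖v‖ := by
    rw [mul_comm]
    exact (norm_inner_le_norm _ _).trans
      (mul_le_mul v.norm_fn_le u.norm_fn_le (norm_nonneg _) (norm_nonneg _))
  calc ‖helmholtzForm Ω ν u v‖ ≤ ‖inner ℂ v.grad u.grad‖ + ‖(ν.1 : ℂ) ^ 2 * inner ℂ v.fn u.fn‖
        + ‖Complex.I * ν.1 / ν.2.2 * boundaryInner Ω 1 u v‖
        + ‖Complex.I * ν.1 * boundaryInner Ω 3 u v‖ := by
        unfold helmholtzForm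
        refine (norm_add_le _ _).trans (add_le_add ((norm_add_le _ _).trans (add_le_add
          (norm_sub_le _ _) le_rfl)) le_rfl)
    _ = ‖inner ℂ v.grad u.grad‖ + ν.1 ^ 2 * ‖inner ℂ v.fn u.fn‖
        + |ν.1| / ‖ν.2.2‖ * ‖boundaryInner Ω 1 u v‖ + |ν.1| * ‖boundaryInner Ω 3 u v‖ := by
        simp
    _ ≤ ‖u‖ * ‖v‖ + ν.1 ^ 2 * (‖u‖ * ‖v‖)
        + |ν.1| / ‖ν.2.2‖ * (T ^ 2 * (‖u‖ * ‖v‖)) + |ν.1| * (T ^ 2 * (‖u‖ * ‖v‖)) := by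
        gcongr <;> apply htr
    _ = _ := by
        simp only [continuityConstant, Param.kξ]
        ring

theorem re_map (𝕃 : Type) [RCLike 𝕃] (z : ℂ) : RCLike.re (RCLike.map ℂ 𝕃 z) = z.re := by
  simp

theorem im_map (𝕃 : Type) [RCLike 𝕃] (z : ℂ) :
    RCLike.im (RCLike.map ℂ 𝕃 z) = z.im * RCLike.im (RCLike.I : 𝕃) := by
  simp

theorem norm_map_le (𝕃 : Type) [RCLike 𝕃] (z : ℂ) : ‖RCLike.map ℂ 𝕃 z‖ ≤ ‖z‖ := by
  refine abs_le_of_sq_le_sq' ?_ (norm_nonneg _) |>.2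
  rw [RCLike.norm_sq_eq_def, RCLike.norm_sq_eq_def, re_map, im_map]
  rcases RCLike.I_eq_zero_or_im_I_eq_one (K := 𝕃) with h | h
  · rw [h]
    simp [mul_self_nonneg]
  · rw [h]
    simp

/-! ### The Céa estimate. -/

/-- Quasi-optimality of the Galerkin solution under a discrete inf-sup condition. -/
theorem norm_sub_le_of_infSup {𝕃 : Type} [RCLike 𝕃] {Ω : AcousticDomain} {ν : Param}
    {V : Set (H1 Ω.D)} (hsub : ∀ u ∈ V, ∀ v ∈ V, u - v ∈ V) (hV : ∀ v ∈ V, v ∈ V0 Ω)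
    {M β : ℝ} (hM : ∀ u v : H1 Ω.D, HasTrace u → HasTrace v →
      ‖helmholtzForm Ω ν u v‖ ≤ M * (‖u‖ * ‖v‖)) (hM0 : 0 ≤ M) (hβ : 0 < β)
    (hβV : ENNReal.ofReal β ≤ infSupConstant 𝕃 Ω V ν) {pg p q pR : H1 Ω.D}
    (hp : IsExactSolution Ω pg ν p) (hq : q ∈ V) (hpR : IsReducedSolution 𝕃 Ω V pg ν pR) :
    ‖p - pR‖ ≤ (1 + M / β) * ‖p - q‖ := by
  have hpT := HasTrace.of_mem_V0 hp.1
  have hqT := HasTrace.of_mem_V0 (hV q hq)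
  have hRT := HasTrace.of_mem_V0 (hV pR hpR.1)
  have key : β * ‖pR - q‖ ≤ M * ‖p - q‖ := by
    by_cases h0 : pR - q = 0
    · rw [h0, norm_zero, mul_zero]
      positivity
    have hpos : 0 < ‖pR - q‖ := norm_pos_iff.2 h0
    -- The infimum is tested at `pR - q`.
    have hle : infSupConstant 𝕃 Ω V ν ≤ ENNReal.ofReal (M * ‖p - q‖ / ‖pR - q‖) := by
      refine (iInf₂_le (pR - q) ⟨hsub _ hpR.1 _ hq, h0⟩).trans (iSup₂_le fun v hv => ?_)
      refine ENNReal.ofReal_le_ofReal ?_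
      have hvpos : 0 < ‖v‖ := norm_pos_iff.2 hv.2
      have hvT := HasTrace.of_mem_V0 (hV v hv.1)
      -- Galerkin orthogonality: `p` and `pR` have the same right-hand side against `v ∈ V`.
      have hgal : RCLike.map ℂ 𝕃 (helmholtzForm Ω ν (pR - q) v) =
          RCLike.map ℂ 𝕃 (helmholtzForm Ω ν (p - q) v) := by
        rw [helmholtzForm_sub_left ν v hRT hqT, helmholtzForm_sub_left ν v hpT hqT, map_sub,
          map_sub, hpR.2 v hv.1, hp.2 v (hV v hv.1)]
      rw [hgal, div_le_div_iff₀ (by positivity) hpos]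
      calc _ ≤ M * (‖p - q‖ * ‖v‖) * ‖pR - q‖ := by
            gcongr
            exact (norm_map_le 𝕃 _).trans (hM _ _ (hpT.sub hqT) hvT)
        _ = _ := by ring
    have h := (ENNReal.ofReal_le_ofReal_iff (by positivity)).1 (hβV.trans hle)
    rwa [le_div_iff₀ hpos] at h
  have h2 : ‖pR - q‖ ≤ M / β * ‖p - q‖ := by
    rw [div_mul_eq_mul_div, le_div_iff₀ hβ, mul_comm]
    exact key
  calc ‖p - pR‖ = ‖(p - q) - (pR - q)‖ := by rw [sub_sub_sub_cancel_right]
    _ ≤ ‖p - q‖ + ‖pR - q‖ := norm_sub_le _ _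
    _ ≤ _ := by linarith

/-! ### Passage between `𝕜` and `ℂ`. -/

section Scalars

variable {𝕜 : Type} [RCLike 𝕜]

theorem map_toComplex_mul (a b : 𝕜) :
    RCLike.map 𝕜 ℂ (a * b) = RCLike.map 𝕜 ℂ a * RCLike.map 𝕜 ℂ b := by
  apply Complex.ext <;> simp

theorem map_toComplex_ofReal (t : ℝ) : RCLike.map 𝕜 ℂ (t : 𝕜) = (t : ℂ) := by
  apply Complex.ext <;> simp

theorem norm_map_toComplex (a : 𝕜) : ‖RCLike.map 𝕜 ℂ a‖ = ‖a‖ := by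
  refine (sq_eq_sq₀ (norm_nonneg _) (norm_nonneg _)).1 ?_
  rw [RCLike.norm_sq_eq_def, RCLike.norm_sq_eq_def]
  simp

/-- For `𝕜 = ℝ` the map is the real part, which is not multiplicative but is linear over the reals;
`RCLike.I_im` covers both fields. -/
theorem map_ofComplex_mul (c : 𝕜) (z : ℂ) :
    RCLike.map ℂ 𝕜 (RCLike.map 𝕜 ℂ c * z) = c * RCLike.map ℂ 𝕜 z := by
  have h := RCLike.I_im c
  have h1 : (RCLike.map 𝕜 ℂ c).re = RCLike.re c := by simp
  have h2 : (RCLike.map 𝕜 ℂ c).im = RCLike.im c := by simp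
  apply RCLike.ext
  · rw [re_map, RCLike.mul_re, re_map, im_map, Complex.mul_re, h1, h2]
    linear_combination z.im * h
  · rw [im_map, RCLike.mul_im, re_map, im_map, Complex.mul_im, h1, h2]
    linear_combination z.re * h

theorem map_ofComplex_conj_mul (c : 𝕜) (z : ℂ) :
    RCLike.map ℂ 𝕜 (starRingEnd ℂ (RCLike.map 𝕜 ℂ c) * z) =
      starRingEnd 𝕜 c * RCLike.map ℂ 𝕜 z := by
  rw [← map_ofComplex_mul]
  congr 2
  apply Complex.ext <;> simp

theorem map_ofComplex_conj (z : ℂ) :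
    RCLike.map ℂ 𝕜 (starRingEnd ℂ z) = starRingEnd 𝕜 (RCLike.map ℂ 𝕜 z) := by
  apply RCLike.ext <;> simp

theorem map_inner_sum_sum {E : Type*} [NormedAddCommGroup E] [InnerProductSpace ℂ E]
    {α β : Type*} (s : Finset α) (t : Finset β) (c : α → 𝕜) (d : β → 𝕜) (x : α → E) (y : β → E) :
    RCLike.map ℂ 𝕜 (inner ℂ (∑ i ∈ s, RCLike.map 𝕜 ℂ (c i) • x i)
      (∑ j ∈ t, RCLike.map 𝕜 ℂ (d j) • y j)) =
    ∑ i ∈ s, ∑ j ∈ t, starRingEnd 𝕜 (c i) * (d j * RCLike.map ℂ 𝕜 (inner ℂ (x i) (y j))) := by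
  simp only [sum_inner, inner_sum, inner_smul_left, inner_smul_right, map_sum,
    map_ofComplex_conj_mul, map_ofComplex_mul, Finset.mul_sum]
  rw [Finset.sum_comm]
  exact Finset.sum_congr rfl fun i _ => Finset.sum_congr rfl fun j _ => mul_left_comm _ _ _

theorem norm_sq_eq_re_map_inner (𝕜 : Type) [RCLike 𝕜] {E : Type*} [NormedAddCommGroup E]
    [InnerProductSpace ℂ E] (x : E) :
    ‖x‖ ^ 2 = RCLike.re (RCLike.map ℂ 𝕜 (inner ℂ x x)) := by
  rw [re_map]
  exact (inner_self_eq_norm_sq (𝕜 := ℂ) x).symm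

theorem map_inner_symm {E : Type*} [NormedAddCommGroup E] [InnerProductSpace ℂ E] (x y : E) :
    starRingEnd 𝕜 (RCLike.map ℂ 𝕜 (inner ℂ x y)) = RCLike.map ℂ 𝕜 (inner ℂ y x) := by
  rw [← map_ofComplex_conj, inner_conj_symm]

end Scalars

/-! ### Uniqueness of the weak gradient, and a first-order minimality condition. -/

section Functions

variable {D : Set Space}

/-- The inclusion `H¹ → L²` as a linear map. -/
def H1.fnₗ (D : Set Space) : H1 D →ₗ[ℂ] L2 D where
  toFun := H1.fn
  map_add' _ _ := rfl
  map_smul' _ _ := rfl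

theorem H1.fnₗ_apply (u : H1 D) : H1.fnₗ D u = u.fn := rfl

theorem H1.inner_eq (u v : H1 D) :
    inner ℂ u v = inner ℂ u.fn v.fn + inner ℂ u.grad v.grad :=
  WithLp.prod_inner_apply _ _

/-- The weak gradient is determined by the function. -/
theorem H1.eq_zero_of_fn_eq_zero (hD : IsOpen D) {u : H1 D} (hu : u.fn = 0) : u = 0 := by
  have hz : u.fn =ᵐ[volume.restrict D] 0 := by
    rw [hu]
    exact Lp.coeFn_zero ℂ 2 _
  have hi : ∀ i : Fin 3, ∀ᵐ x ∂volume.restrict D, u.grad x i = 0 := by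
    intro i
    have hmem : MemLp (fun x => u.grad x i) 2 (volume.restrict D) :=
      (EuclideanSpace.proj (𝕜 := ℂ) i).comp_memLp' (Lp.memLp u.grad)
    -- Fundamental lemma of the calculus of variations: each gradient component integrates to zero
    -- against every test function.
    have := hD.ae_eq_zero_of_integral_contDiff_smul_eq_zero (μ := volume.restrict D)
      (f := fun x => u.grad x i)
      ((hmem.locallyIntegrable (by norm_num)).locallyIntegrableOn D) (fun φ h1 h2 h3 => by
        have h := u.2 φ ⟨h1, h2, h3⟩ i
        have h0 : ∫ x in D, u.fn x * ((partialDeriv i φ x : ℝ) : ℂ) = 0 := by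
          refine integral_eq_zero_of_ae ?_
          filter_upwards [hz] with x hx
          simp [hx]
        rw [show u.1.fst = u.fn from rfl, h0, zero_eq_neg] at h
        rw [← h]
        refine integral_congr_ae (Eventually.of_forall fun x => ?_)
        change (φ x : ℝ) • u.grad x i = u.grad x i * (φ x : ℂ)
        rw [Complex.real_smul, mul_comm])
    filter_upwards [this, ae_restrict_mem hD.measurableSet] with x hx hxD using hx hxD
  have hg : u.grad = 0 := by
    refine Lp.ext ?_
    filter_upwards [ae_all_iff.2 hi, Lp.coeFn_zero (EuclideanSpace ℂ (Fin 3)) 2 (volume.restrict D)]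
      with x hx h0
    rw [h0]
    ext i
    exact hx i
  have h : ‖u‖ ^ 2 = 0 := by
    rw [norm_sq_eq_re_map_inner ℝ, H1.inner_eq, hu, hg]
    simp
  exact norm_eq_zero.1 (pow_eq_zero_iff two_ne_zero |>.1 h)

/-- A nonnegative quadratic in `t` without constant term has no linear term. Only real `t` are used,
since the reduced space may be merely real-linear. -/
theorem real_inner_eq_zero_of_norm_le {E : Type*} [NormedAddCommGroup E] [InnerProductSpace ℂ E]
    {a v : E} (h : ∀ t : ℝ, ‖a‖ ≤ ‖a - (t : ℂ) • v‖) : (inner ℂ a v : ℂ).re = 0 := by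
  set c := (inner ℂ a v : ℂ).re
  have hq : ∀ t : ℝ, 0 ≤ ‖v‖ ^ 2 * (t * t) + (-2 * c) * t + 0 := by
    intro t
    have h1 := pow_le_pow_left₀ (norm_nonneg _) (h t) 2
    rw [norm_sub_sq (𝕜 := ℂ), inner_smul_right, norm_smul, mul_pow] at h1
    have h2 : RCLike.re ((t : ℂ) * inner ℂ a v) = t * c := by
      simp [c]
    rw [h2, Complex.norm_real, Real.norm_eq_abs, sq_abs] at h1
    nlinarith
  have := discrim_le_zero hq
  rw [discrim] at this
  nlinarith [sq_nonneg c]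

end Functions

/-! ### Linear algebra of the correlation matrix. -/

section Eigensystem

variable {𝕜 : Type} [RCLike 𝕜] {m d : ℕ} {A : Matrix (Fin m) (Fin m) 𝕜} {lam : Fin d → ℝ}
  {u : Fin d → Fin m → 𝕜}

theorem IsEigensystem.orthonormal_toLp (h : IsEigensystem A lam u) :
    Orthonormal 𝕜 fun i => (WithLp.toLp 2 (u i) : EuclideanSpace 𝕜 (Fin m)) := by
  rw [orthonormal_iff_ite]
  intro i j
  rw [EuclideanSpace.inner_eq_star_dotProduct, dotProduct_comm]
  exact h.orthonormal i j

/-- Bessel's inequality for the `j`-th coordinate vector. -/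
theorem IsEigensystem.sum_norm_sq_le_one (h : IsEigensystem A lam u) (j : Fin m) :
    ∑ i, ‖u i j‖ ^ 2 ≤ 1 := by
  have := h.orthonormal_toLp.sum_inner_products_le (EuclideanSpace.single j (1 : 𝕜))
    (s := Finset.univ)
  simpa [EuclideanSpace.inner_single_right] using this

/-- Nonzero eigenvalues put every `u i` in the range, and both spaces have dimension `d`. -/
theorem IsEigensystem.range_mulVecLin (h : IsEigensystem A lam u) :
    LinearMap.range A.mulVecLin = Submodule.span 𝕜 (Set.range u) := by
  symm
  refine Submodule.eq_of_le_of_finrank_eq (Submodule.span_le.2 ?_) ?_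
  · rintro _ ⟨i, rfl⟩
    refine ⟨((lam i : 𝕜))⁻¹ • u i, ?_⟩
    have : (lam i : 𝕜) ≠ 0 := by exact_mod_cast (h.pos i).ne'
    rw [map_smul, Matrix.mulVecLin_apply, h.eigen, smul_smul, inv_mul_cancel₀ this, one_smul]
  · have hli : LinearIndependent 𝕜 u :=
      h.orthonormal_toLp.linearIndependent.map' (WithLp.linearEquiv 2 𝕜 (Fin m → 𝕜)).toLinearMap
        (LinearEquiv.ker _)
    rw [finrank_span_eq_card hli, Fintype.card_fin]
    exact h.rank_eq.symm

/-- The vector `c` in parentheses is orthogonal to the range of `A`; as `A` is Hermitian, `‖A c‖² =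
⟨A (A c), c⟩ = 0`. -/
theorem IsEigensystem.mulVec_single_sub (h : IsEigensystem A lam u) (hA : A.IsHermitian)
    (j : Fin m) :
    A.mulVec (Pi.single j 1 - ∑ i, starRingEnd 𝕜 (u i j) • u i) = 0 := by
  set c : Fin m → 𝕜 := Pi.single j 1 - ∑ i, starRingEnd 𝕜 (u i j) • u i with hc
  have horth : ∀ k, star (u k) ⬝ᵥ c = 0 := by
    intro k
    rw [hc, dotProduct_sub, dotProduct_sum]
    simp [dotProduct_smul, h.orthonormal]
  have hrange : ∀ y ∈ Submodule.span 𝕜 (Set.range u), star y ⬝ᵥ c = 0 := by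
    intro y hy
    induction hy using Submodule.span_induction with
    | mem x hx => obtain ⟨k, rfl⟩ := hx; exact horth k
    | zero => simp
    | add x y _ _ hx hy => rw [star_add, add_dotProduct, hx, hy, add_zero]
    | smul a x _ hx => rw [star_smul, smul_dotProduct, hx, smul_zero]
  have h0 : star (A.mulVec c) ⬝ᵥ A.mulVec c = 0 := by
    have h1 : star (A.mulVec (A.mulVec c)) ⬝ᵥ c = 0 :=
      hrange _ (h.range_mulVecLin ▸ ⟨A.mulVec c, rfl⟩)
    rwa [Matrix.star_mulVec, hA.eq, ← Matrix.dotProduct_mulVec] at h1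
  open ComplexOrder in exact dotProduct_star_self_eq_zero.1 h0

end Eigensystem

/-! ### `L²` orthonormality of the modes and expansion of the snapshots. -/

section Modes

variable {𝕜 : Type} [RCLike 𝕜] {D : Set Space} {m d : ℕ} {snap : Fin m → H1 D} {lam : Fin d → ℝ}
  {u : Fin d → Fin m → 𝕜}

theorem isHermitian_correlationMatrix (snap : Fin m → H1 D) :
    (correlationMatrix 𝕜 snap).IsHermitian := by
  ext i j
  exact map_inner_symm _ _

theorem map_inner_combination (snap : Fin m → H1 D) (a b : Fin m → 𝕜) :
    RCLike.map ℂ 𝕜 (inner ℂ (∑ j, RCLike.map 𝕜 ℂ (a j) • snap j).fn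
      (∑ j, RCLike.map 𝕜 ℂ (b j) • snap j).fn) =
      star a ⬝ᵥ (correlationMatrix 𝕜 snap).mulVec b := by
  simp only [← H1.fnₗ_apply, map_sum, map_smul]
  rw [map_inner_sum_sum]
  simp only [dotProduct, Matrix.mulVec, Finset.mul_sum, Pi.star_apply, correlationMatrix,
    Matrix.of_apply, H1.fnₗ_apply]
  exact Finset.sum_congr rfl fun i _ => Finset.sum_congr rfl fun j _ => by
    rw [mul_comm (b j)]; rfl

theorem podMode_eq (i : Fin d) :
    podMode snap lam u i = ∑ j, RCLike.map 𝕜 ℂ ((((1 / √(lam i) : ℝ) : 𝕜) • u i) j) • snap j := by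
  rw [podMode, Finset.smul_sum]
  refine Finset.sum_congr rfl fun j _ => ?_
  rw [Pi.smul_apply, smul_eq_mul, map_toComplex_mul, map_toComplex_ofReal, smul_smul]

/-- The eigenvector relation gives `uᵢ* C u_k = λ_k δ_{ik}`, and the two normalizing factors cancel
`λ_k`. -/
theorem IsEigensystem.map_inner_podMode
    (h : IsEigensystem (correlationMatrix 𝕜 snap) lam u) (i k : Fin d) :
    RCLike.map ℂ 𝕜 (inner ℂ (podMode snap lam u i).fn (podMode snap lam u k).fn) =
      if i = k then 1 else 0 := by
  rw [podMode_eq, podMode_eq, map_inner_combination, Matrix.mulVec_smul, h.eigen, star_smul,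
    smul_dotProduct, dotProduct_smul, dotProduct_smul, h.orthonormal]
  split_ifs with hik
  · subst hik
    have h1 : (1 / √(lam i)) * ((1 / √(lam i)) * lam i) = 1 := by
      have := Real.sqrt_pos.2 (h.pos i)
      have h2 := Real.mul_self_sqrt (h.pos i).le
      field_simp
      nlinarith
    simp only [smul_eq_mul, mul_one, RCLike.star_def, RCLike.conj_ofReal]
    exact_mod_cast congrArg (fun t : ℝ => (t : 𝕜)) h1
  · simp

/-- Each snapshot is recovered from the modes. -/
theorem IsEigensystem.snap_eq (hD : IsOpen D)
    (h : IsEigensystem (correlationMatrix 𝕜 snap) lam u) (j : Fin m) :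
    snap j = ∑ i, RCLike.map 𝕜 ℂ (((√(lam i) : ℝ) : 𝕜) * starRingEnd 𝕜 (u i j)) •
      podMode snap lam u i := by
  set c : Fin m → 𝕜 := Pi.single j 1 - ∑ i, starRingEnd 𝕜 (u i j) • u i with hc
  -- As `c` lies in the kernel of the correlation matrix, this combination has zero `L²` norm, hence
  -- is zero in `H¹` too.
  have hz : ∑ l, RCLike.map 𝕜 ℂ (c l) • snap l = 0 := by
    refine H1.eq_zero_of_fn_eq_zero hD ?_
    have h2 := norm_sq_eq_re_map_inner 𝕜 (∑ l, RCLike.map 𝕜 ℂ (c l) • snap l).fn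
    rw [map_inner_combination, h.mulVec_single_sub (isHermitian_correlationMatrix snap),
      dotProduct_zero, map_zero] at h2
    exact norm_eq_zero.1 (pow_eq_zero_iff two_ne_zero |>.1 h2)
  have hexp : ∑ l, RCLike.map 𝕜 ℂ (c l) • snap l = snap j -
      ∑ i, ∑ l, RCLike.map 𝕜 ℂ (starRingEnd 𝕜 (u i j) * u i l) • snap l := by
    have hl : ∀ l, RCLike.map 𝕜 ℂ (c l) • snap l = (if l = j then snap l else 0) -
        ∑ i, RCLike.map 𝕜 ℂ (starRingEnd 𝕜 (u i j) * u i l) • snap l := by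
      intro l
      rw [hc, Pi.sub_apply, map_sub, sub_smul, Finset.sum_apply, map_sum, Finset.sum_smul]
      congr 1
      rw [Pi.single_apply]
      split_ifs
      · rw [← RCLike.ofReal_one, map_toComplex_ofReal, Complex.ofReal_one, one_smul]
      · rw [map_zero, zero_smul]
    rw [Finset.sum_congr rfl fun l _ => hl l, Finset.sum_sub_distrib, Finset.sum_comm]
    simp
  rw [hexp, sub_eq_zero] at hz
  rw [hz]
  refine Finset.sum_congr rfl fun i _ => ?_
  rw [podMode_eq, Finset.smul_sum]
  refine Finset.sum_congr rfl fun l _ => ?_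
  rw [smul_smul, ← map_toComplex_mul]
  congr 2
  have h1 : ((√(lam i) : ℝ) : 𝕜) * ((1 / √(lam i) : ℝ) : 𝕜) = 1 := by
    have := (Real.sqrt_pos.2 (h.pos i)).ne'
    rw [← RCLike.ofReal_mul, mul_one_div_cancel this, RCLike.ofReal_one]
  rw [Pi.smul_apply, smul_eq_mul]
  linear_combination (-(starRingEnd 𝕜 (u i j)) * u i l) * h1

end Modes

/-! ### The reduced space, its `L²` projection and its stiffness matrix. -/

section Reduced

variable {𝕜 : Type} [RCLike 𝕜] {D : Set Space} {d N : ℕ} {φ : Fin d → H1 D} {hN : N ≤ d}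

theorem reducedSpace_sub {v w : H1 D} (hv : v ∈ reducedSpace 𝕜 φ N hN)
    (hw : w ∈ reducedSpace 𝕜 φ N hN) : v - w ∈ reducedSpace 𝕜 φ N hN := by
  obtain ⟨a, rfl⟩ := hv
  obtain ⟨b, rfl⟩ := hw
  exact ⟨a - b, by simp only [Pi.sub_apply, map_sub, sub_smul, Finset.sum_sub_distrib]⟩

theorem reducedSpace_add {v w : H1 D} (hv : v ∈ reducedSpace 𝕜 φ N hN)
    (hw : w ∈ reducedSpace 𝕜 φ N hN) : v + w ∈ reducedSpace 𝕜 φ N hN := by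
  obtain ⟨a, rfl⟩ := hv
  obtain ⟨b, rfl⟩ := hw
  exact ⟨a + b, by simp only [Pi.add_apply, map_add, add_smul, Finset.sum_add_distrib]⟩

theorem reducedSpace_smul {v : H1 D} (t : ℝ) (hv : v ∈ reducedSpace 𝕜 φ N hN) :
    (t : ℂ) • v ∈ reducedSpace 𝕜 φ N hN := by
  obtain ⟨a, rfl⟩ := hv
  refine ⟨(t : 𝕜) • a, ?_⟩
  rw [Finset.smul_sum]
  refine Finset.sum_congr rfl fun i _ => ?_
  rw [Pi.smul_apply, smul_eq_mul, map_toComplex_mul, map_toComplex_ofReal, smul_smul]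

theorem IsL2Projection.re_inner_eq_zero {p q v : H1 D}
    (h : IsL2Projection (reducedSpace 𝕜 φ N hN) p q) (hv : v ∈ reducedSpace 𝕜 φ N hN) :
    (inner ℂ (p.fn - q.fn) v.fn : ℂ).re = 0 := by
  refine real_inner_eq_zero_of_norm_le fun t => ?_
  refine (h.2 _ (reducedSpace_add h.1 (reducedSpace_smul t hv))).trans_eq ?_
  rw [show (q + (t : ℂ) • v).fn = q.fn + (t : ℂ) • v.fn from rfl, sub_sub]

theorem norm_sq_combination_eq {n : ℕ} (ψ : Fin n → H1 D) (a : Fin n → 𝕜) :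
    ‖∑ i, RCLike.map 𝕜 ℂ (a i) • ψ i‖ ^ 2 =
      RCLike.re (star a ⬝ᵥ (stiffnessMatrix 𝕜 ψ).mulVec a) := by
  rw [norm_sq_eq_re_map_inner 𝕜]
  refine (congrArg RCLike.re
    (map_inner_sum_sum (E := H1 D) Finset.univ Finset.univ a a ψ ψ)).trans ?_
  simp only [dotProduct, Matrix.mulVec, Finset.mul_sum, Pi.star_apply, stiffnessMatrix,
    Matrix.of_apply, H1.inner_eq]
  exact congrArg _ (Finset.sum_congr rfl fun i _ => Finset.sum_congr rfl fun j _ => by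
    rw [mul_comm (a j)]; rfl)

theorem norm_sq_combination_le {n : ℕ} (ψ : Fin n → H1 D) (a : Fin n → 𝕜) :
    ‖∑ i, RCLike.map 𝕜 ℂ (a i) • ψ i‖ ^ 2 ≤ twoNorm (stiffnessMatrix 𝕜 ψ) * ∑ i, ‖a i‖ ^ 2 := by
  set S := stiffnessMatrix 𝕜 ψ
  set x : EuclideanSpace 𝕜 (Fin n) := WithLp.toLp 2 a
  have h1 : star a ⬝ᵥ S.mulVec a = inner 𝕜 x (Matrix.toEuclideanCLM (n := Fin n) (𝕜 := 𝕜) S x) := by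
    rw [EuclideanSpace.inner_eq_star_dotProduct, dotProduct_comm]
    rfl
  rw [norm_sq_combination_eq, h1, ← EuclideanSpace.norm_sq_eq x]
  calc _ ≤ ‖x‖ * ‖Matrix.toEuclideanCLM (n := Fin n) (𝕜 := 𝕜) S x‖ := re_inner_le_norm _ _
    _ ≤ ‖x‖ * (twoNorm S * ‖x‖) := by
      gcongr
      exact ContinuousLinearMap.le_opNorm _ _
    _ = _ := by ring

theorem sum_castLE {M : Type*} [AddCommMonoid M] (hN : N ≤ d) (f : Fin d → M) :
    ∑ i : Fin N, f (Fin.castLE hN i) = ∑ i ∈ Finset.univ.filter (fun i : Fin d => i.val < N), f i := by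
  refine Finset.sum_bij' (fun i _ => Fin.castLE hN i)
    (fun i hi => ⟨i.val, (Finset.mem_filter.1 hi).2⟩) ?_ ?_ ?_ ?_ ?_ <;> simp

end Reduced

/-! ### The projection error. -/

section Estimate

variable {𝕜 : Type} [RCLike 𝕜] {D : Set Space} {m d N : ℕ} {snap : Fin m → H1 D}
  {lam : Fin d → ℝ} {u : Fin d → Fin m → 𝕜} {hN : N ≤ d}

/-- Conformity of the reduced space, needed to test the exact equation on it. -/
theorem mem_of_mem_reducedSpace {Vh : Submodule ℂ (H1 D)} (hs : ∀ j, snap j ∈ Vh) {v : H1 D}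
    (hv : v ∈ reducedSpace 𝕜 (podMode snap lam u) N hN) : v ∈ Vh := by
  obtain ⟨c, rfl⟩ := hv
  exact Vh.sum_mem fun i _ => Vh.smul_mem _
    (Vh.smul_mem _ (Vh.sum_mem fun j _ => Vh.smul_mem _ (hs j)))

/-- The `L²` norm of a combination of the leading modes controls its `H¹` norm. -/
theorem IsEigensystem.norm_le_of_mem_reducedSpace
    (h : IsEigensystem (correlationMatrix 𝕜 snap) lam u) {v : H1 D}
    (hv : v ∈ reducedSpace 𝕜 (podMode snap lam u) N hN) :
    ‖v‖ ≤ twoNorm (stiffnessMatrix 𝕜 fun i : Fin N => podMode snap lam u (Fin.castLE hN i))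
      ^ (1 / 2 : ℝ) * ‖v.fn‖ := by
  obtain ⟨a, rfl⟩ := hv
  have h1 := norm_sq_combination_le (fun i : Fin N => podMode snap lam u (Fin.castLE hN i)) a
  -- Parseval for the `L²`-orthonormal modes.
  have h2 : ‖(∑ i, RCLike.map 𝕜 ℂ (a i) • podMode snap lam u (Fin.castLE hN i)).fn‖ ^ 2 =
      ∑ i, ‖a i‖ ^ 2 := by
    rw [norm_sq_eq_re_map_inner 𝕜]
    simp only [← H1.fnₗ_apply, map_sum, map_smul]
    rw [map_inner_sum_sum, map_sum]
    simp only [H1.fnₗ_apply, h.map_inner_podMode, (Fin.castLE_injective hN).eq_iff]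
    refine Finset.sum_congr rfl fun i _ => ?_
    simp [RCLike.conj_mul]
  rw [← h2] at h1
  have hS : 0 ≤ twoNorm (stiffnessMatrix 𝕜 fun i : Fin N =>
      podMode snap lam u (Fin.castLE hN i)) := norm_nonneg _
  rw [← Real.sqrt_eq_rpow]
  refine abs_le_of_sq_le_sq' ?_ (by positivity) |>.2
  rwa [mul_pow, Real.sq_sqrt hS]

/-- The truncated modal expansion of the `j`-th snapshot. -/
def truncation (snap : Fin m → H1 D) (lam : Fin d → ℝ) (u : Fin d → Fin m → 𝕜) (N : ℕ) (j : Fin m) :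
    H1 D :=
  ∑ i ∈ Finset.univ.filter (fun i : Fin d => i.val < N),
    RCLike.map 𝕜 ℂ (((√(lam i) : ℝ) : 𝕜) * starRingEnd 𝕜 (u i j)) • podMode snap lam u i

theorem truncation_mem (snap : Fin m → H1 D) (lam : Fin d → ℝ) (u : Fin d → Fin m → 𝕜) (hN : N ≤ d)
    (j : Fin m) : truncation snap lam u N j ∈ reducedSpace 𝕜 (podMode snap lam u) N hN :=
  ⟨_, (sum_castLE hN fun i => RCLike.map 𝕜 ℂ (((√(lam i) : ℝ) : 𝕜) * starRingEnd 𝕜 (u i j)) •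
    podMode snap lam u i).symm⟩

theorem IsEigensystem.snap_sub_truncation (hD : IsOpen D)
    (h : IsEigensystem (correlationMatrix 𝕜 snap) lam u) (N : ℕ) (j : Fin m) :
    snap j - truncation snap lam u N j =
      ∑ i ∈ Finset.univ.filter (fun i : Fin d => N ≤ i.val),
        RCLike.map 𝕜 ℂ (((√(lam i) : ℝ) : 𝕜) * starRingEnd 𝕜 (u i j)) • podMode snap lam u i := by
  conv_lhs => rw [h.snap_eq hD j, truncation]
  rw [sub_eq_iff_eq_add', ← Finset.sum_filter_add_sum_filter_not Finset.univ
    (fun i : Fin d => i.val < N)]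
  simp only [not_lt]

/-- The tail uses only modes of index at least `N`, so the truncation is the `L²` projection of the
snapshot. -/
theorem IsEigensystem.re_inner_snap_sub_truncation (hD : IsOpen D)
    (h : IsEigensystem (correlationMatrix 𝕜 snap) lam u) (j : Fin m) {v : H1 D}
    (hv : v ∈ reducedSpace 𝕜 (podMode snap lam u) N hN) :
    (inner ℂ ((snap j).fn - (truncation snap lam u N j).fn) v.fn : ℂ).re = 0 := by
  obtain ⟨a, rfl⟩ := hv
  rw [show (snap j).fn - (truncation snap lam u N j).fn = (snap j - truncation snap lam u N j).fn
    from rfl, h.snap_sub_truncation hD, ← re_map 𝕜]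
  simp only [← H1.fnₗ_apply, map_sum, map_smul]
  rw [map_inner_sum_sum]
  simp only [H1.fnₗ_apply, h.map_inner_podMode]
  rw [Finset.sum_eq_zero, map_zero]
  intro i hi
  refine Finset.sum_eq_zero fun k _ => ?_
  have : i ≠ Fin.castLE hN k := by
    rintro rfl
    have := (Finset.mem_filter.1 hi).2
    simp at this
    omega
  rw [if_neg this, mul_zero, mul_zero]

theorem re_stiffnessMatrix_self {n : ℕ} (ψ : Fin n → H1 D) (i : Fin n) :
    RCLike.re (stiffnessMatrix 𝕜 ψ i i) = ‖ψ i‖ ^ 2 := by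
  rw [norm_sq_eq_re_map_inner 𝕜, H1.inner_eq]
  rfl

/-- The modes need not be orthogonal in `H¹`. The triangle inequality and Cauchy-Schwarz suffice,
the coefficients `u i j` having squared sum at most 1 over `i`. -/
theorem IsEigensystem.norm_snap_sub_truncation_le (hD : IsOpen D)
    (h : IsEigensystem (correlationMatrix 𝕜 snap) lam u) (N : ℕ) (j : Fin m) :
    ‖snap j - truncation snap lam u N j‖ ≤
      (∑ i ∈ (Finset.univ : Finset (Fin d)).filter (fun i => N ≤ i.val),
        lam i * RCLike.re (stiffnessMatrix 𝕜 (podMode snap lam u) i i)) ^ (1 / 2 : ℝ) := by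
  set s := (Finset.univ : Finset (Fin d)).filter (fun i => N ≤ i.val)
  have h1 : ‖snap j - truncation snap lam u N j‖ ≤
      ∑ i ∈ s, ‖u i j‖ * (√(lam i) * ‖podMode snap lam u i‖) := by
    rw [h.snap_sub_truncation hD]
    refine (norm_sum_le _ _).trans_eq (Finset.sum_congr rfl fun i _ => ?_)
    rw [norm_smul, norm_map_toComplex, norm_mul, RCLike.norm_conj, RCLike.norm_ofReal,
      abs_of_nonneg (Real.sqrt_nonneg _)]
    ring
  have h2 : ∑ i ∈ s, ‖u i j‖ ^ 2 ≤ 1 :=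
    (Finset.sum_le_univ_sum_of_nonneg fun i => by positivity).trans (h.sum_norm_sq_le_one j)
  have h3 : ∑ i ∈ s, (√(lam i) * ‖podMode snap lam u i‖) ^ 2 =
      ∑ i ∈ s, lam i * RCLike.re (stiffnessMatrix 𝕜 (podMode snap lam u) i i) := by
    refine Finset.sum_congr rfl fun i _ => ?_
    rw [mul_pow, Real.sq_sqrt (h.pos i).le, re_stiffnessMatrix_self]
  rw [← Real.sqrt_eq_rpow, ← h3]
  refine h1.trans (Real.le_sqrt_of_sq_le ?_)
  refine (Finset.sum_mul_sq_le_sq_mul_sq s _ _).trans ?_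
  exact mul_le_of_le_one_left (Finset.sum_nonneg fun i _ => sq_nonneg _) h2

/-- The projection error of `p` in terms of its distance to a snapshot. -/
theorem IsEigensystem.norm_sub_projection_le (hD : IsOpen D)
    (h : IsEigensystem (correlationMatrix 𝕜 snap) lam u) {p q : H1 D}
    (hq : IsL2Projection (reducedSpace 𝕜 (podMode snap lam u) N hN) p q) (j : Fin m) :
    ‖p - q‖ ≤
      (1 + twoNorm (stiffnessMatrix 𝕜 fun i : Fin N => podMode snap lam u (Fin.castLE hN i))
        ^ (1 / 2 : ℝ)) * ‖p - snap j‖ +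
      (∑ i ∈ (Finset.univ : Finset (Fin d)).filter (fun i => N ≤ i.val),
        lam i * RCLike.re (stiffnessMatrix 𝕜 (podMode snap lam u) i i)) ^ (1 / 2 : ℝ) := by
  set s := truncation snap lam u N j
  have hv : q - s ∈ reducedSpace 𝕜 (podMode snap lam u) N hN :=
    reducedSpace_sub hq.1 (truncation_mem snap lam u hN j)
  -- The residuals `p - q` and `snap j - s` are orthogonal to `q - s`, so `q - s` acts as the `L²`
  -- projection of `p - snap j`.
  have hfn : ‖(q - s).fn‖ ≤ ‖p - snap j‖ := by
    refine le_trans ?_ (p - snap j).norm_fn_le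
    have h1 := hq.re_inner_eq_zero hv
    have h2 := h.re_inner_snap_sub_truncation hD j hv
    have h3 : ‖(q - s).fn‖ ^ 2 = (inner ℂ (p - snap j).fn (q - s).fn : ℂ).re := by
      have e : (p - snap j).fn =
          (q - s).fn + (p.fn - q.fn) - ((snap j).fn - (truncation snap lam u N j).fn) := by
        rw [show (p - snap j).fn = p.fn - (snap j).fn from rfl,
          show (q - s).fn = q.fn - (truncation snap lam u N j).fn from rfl]
        abel
      rw [e, inner_sub_left, inner_add_left, Complex.sub_re, Complex.add_re, h1, h2, add_zero,
        sub_zero]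
      exact (inner_self_eq_norm_sq (𝕜 := ℂ) _).symm
    have h4 : ‖(q - s).fn‖ * ‖(q - s).fn‖ ≤ ‖(p - snap j).fn‖ * ‖(q - s).fn‖ := by
      rw [← sq, h3]
      exact re_inner_le_norm (𝕜 := ℂ) _ _
    rcases (norm_nonneg (q - s).fn).eq_or_lt with h0 | h0
    · rw [← h0]
      exact norm_nonneg _
    · exact le_of_mul_le_mul_right h4 h0
  have hS : 0 ≤ twoNorm (stiffnessMatrix 𝕜 fun i : Fin N =>
      podMode snap lam u (Fin.castLE hN i)) ^ (1 / 2 : ℝ) :=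
    Real.rpow_nonneg (norm_nonneg _) _
  calc ‖p - q‖ = ‖(p - snap j) + (snap j - s) - (q - s)‖ := by congr 1; abel
    _ ≤ ‖p - snap j‖ + ‖snap j - s‖ + ‖q - s‖ :=
      (norm_sub_le _ _).trans (add_le_add (norm_add_le _ _) le_rfl)
    _ ≤ ‖p - snap j‖ + _ + _ * ‖p - snap j‖ :=
      add_le_add (add_le_add le_rfl (h.norm_snap_sub_truncation_le hD N j))
        ((h.norm_le_of_mem_reducedSpace hv).trans (mul_le_mul_of_nonneg_left hfn hS))
    _ = _ := by ring

end Estimate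

end HelmholtzPOD

end
-- The two error estimates.
open HelmholtzPOD in
theorem mainTheorem5 (Ω : AcousticDomain) :
    ∃ C : ℝ × ℂ → ℝ, ContinuousOn C admissible ∧ (∀ s ∈ admissible, 0 < C s) ∧
    ∀ (𝕜 𝕃 : Type) [RCLike 𝕜] [RCLike 𝕃]
      -- Dirichlet data on the source boundary and its harmonic lifting
      (g : Space → ℂ) (pg : H1 Ω.D), IsHarmonicLift Ω g pg →
    -- parameter set, conforming finite element space, mesh size
    ∀ (P : Set Param), (∀ ν ∈ P, ν.kξ ∈ admissible) →
    ∀ (Vh : Submodule ℂ (H1 Ω.D)), FiniteDimensional ℂ Vh → (∀ v ∈ Vh, v ∈ V0 Ω) →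
    ∀ h : ℝ, 0 < h →
    -- finite element error bound
    ∀ Cfe : Param → ℝ, ContinuousOn Cfe P →
      (∀ ν ∈ P, ∀ p ph : H1 Ω.D, IsExactSolution Ω pg ν p → IsFESolution Ω Vh pg ν ph →
        ‖p - ph‖ ≤ Cfe ν * h) →
    -- samples, exact and discrete snapshots
    ∀ (m : ℕ), 0 < m → ∀ (νS : Fin m → Param), (∀ j, νS j ∈ P) →
    ∀ (pS pSh : Fin m → H1 Ω.D), (∀ j, IsExactSolution Ω pg (νS j) (pS j)) →
      (∀ j, IsFESolution Ω Vh pg (νS j) (pSh j)) →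
    -- eigenpairs of the correlation matrix, number of retained modes
    ∀ (d : ℕ) (lam : Fin d → ℝ) (u : Fin d → Fin m → 𝕜),
      IsEigensystem (correlationMatrix 𝕜 pSh) lam u →
    ∀ (N : ℕ) (hN : N ≤ d),
    -- discrete inf-sup condition
    ∀ βR : ℝ × ℂ → ℝ, ContinuousOn βR (Param.kξ '' P) →
      (∀ ν ∈ P, 0 < βR ν.kξ ∧ ENNReal.ofReal (βR ν.kξ) ≤
        infSupConstant 𝕃 Ω (reducedSpace 𝕜 (podMode pSh lam u) N hN) ν) →
    -- the two estimates
    ∀ ν ∈ P, ∀ p q : H1 Ω.D, IsExactSolution Ω pg ν p →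
      IsL2Projection (reducedSpace 𝕜 (podMode pSh lam u) N hN) p q →
      (∀ pR : H1 Ω.D,
        IsReducedSolution 𝕃 Ω (reducedSpace 𝕜 (podMode pSh lam u) N hN) pg ν pR →
        ‖p - pR‖ ≤ (1 + C ν.kξ / βR ν.kξ) * ‖p - q‖) ∧
      ‖p - q‖ ≤
        (1 + twoNorm (stiffnessMatrix 𝕜 fun i : Fin N => podMode pSh lam u (Fin.castLE hN i))
              ^ (1 / 2 : ℝ)) *
            (⨅ j : Fin m, (‖p - pS j‖ + Cfe (νS j) * h)) +
          (∑ i ∈ (Finset.univ : Finset (Fin d)).filter (fun i => N ≤ i.val),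
            lam i * RCLike.re (stiffnessMatrix 𝕜 (podMode pSh lam u) i i)) ^ (1 / 2 : ℝ) := by
  -- `T` depends only on the domain, so `C` is fixed before all other data.
  obtain ⟨T, -, hT⟩ := exists_trace_bound Ω
  refine ⟨continuityConstant T, continuousOn_continuityConstant T,
    fun s _ => continuityConstant_pos T s, ?_⟩
  intro 𝕜 𝕃 _ _ g pg _ P _ Vh _ hVh h _ Cfe _ hfe m hm νS hνS pS pSh hpS hpSh d lam u hu N hN βR _
    hβ ν hν p q hp hq
  refine ⟨fun pR hpR => ?_, ?_⟩
  · exact norm_sub_le_of_infSup (fun _ hv _ hw => reducedSpace_sub hv hw)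
      (fun v hv => hVh v (mem_of_mem_reducedSpace (fun j => (hpSh j).1) hv))
      (fun v w hv hw => norm_helmholtzForm_le hT ν hv hw) (continuityConstant_pos T _).le
      (hβ ν hν).1 (hβ ν hν).2 hp hq.1 hpR
  -- With `m > 0` the infimum is attained, and the estimate is used at a minimizing snapshot.
  · have : Nonempty (Fin m) := ⟨⟨0, hm⟩⟩
    obtain ⟨j, hj⟩ := exists_eq_ciInf_of_finite (f := fun j : Fin m => ‖p - pS j‖ + Cfe (νS j) * h)
    rw [← hj]
    refine (hu.norm_sub_projection_le Ω.isOpen hq j).trans (add_le_add ?_ le_rfl)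
    refine mul_le_mul_of_nonneg_left ?_
      (add_nonneg zero_le_one (Real.rpow_nonneg (norm_nonneg _) _))
    calc ‖p - pSh j‖ = ‖(p - pS j) + (pS j - pSh j)‖ := by rw [sub_add_sub_cancel]
      _ ≤ _ := (norm_add_le _ _).trans
        (add_le_add le_rfl (hfe _ (hνS j) _ _ (hpS j) (hpSh j)))
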